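/- **Theorem 3.1.** Let $K$ be a field, $R=\bigoplus_{p\in\mathbb N}R_p$ a positively graded associative unital $K$-algebra, $F=\{f_j\}_{j\in J}$ a family of elements of $R$, $I$ the two-sided ideal of $R$ generated by $F$, and $A=R/I$. For $0\ne f\in R$ let $\deg f$ be the largest $p$ for which the component of $f$ in $R_p$ is nonzero, and let $\mathbf{LH}(f)\in R_{\deg f}$ be that component; put $\deg 0=0$ and $\mathbf{LH}(0)=0$. Write $\langle S\rangle$ for the two-sided ideal generated by $S$, $\mathbf{LH}(F)=\{\mathbf{LH}(f_j)\}_{j\in J}$ and $\mathbf{LH}(I)=\{\mathbf{LH}(f): f\in I\}$. Let $F_pR=\bigoplus_{i\le p}R_i$, let $F_pA=(F_pR+I)/I$, let $G(A)=\bigoplus_p F_pA/F_{p-1}A$ (with $F_{-1}A=0$), and let $\phi:R\to G(A)$ be the natural graded map, sending $r\in R_p$ to the class of $r+I$ in $F_pA/F_{p-1}A$. Let $U$ be the $K$-vector space with basis $X=\{x_j\}_{j\in J}$. For a family $c=\{c_j\}_{j\in J}$ in $R$, the Shafarevich complex $\mathrm{Sh}(X|c,R)$ is the complex of $R$-$R$-bimodules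 $\mathrm{Sh}_n=R\otimes_K U\otimes_K R\otimes_K\cdots\otimes_K U\otimes_K R$ ($n$ factors $U$, $n+1$ factors $R$), $n\ge 0$, with $$d_n(a_0\otimes x_{j_1}\otimes a_1\otimes\cdots\otimes x_{j_n}\otimes a_n)=\sum_{i=1}^n(-1)^{i-1}a_0\otimes x_{j_1}\otimes\cdots\otimes x_{j_{i-1}}\otimes(a_{i-1}c_{j_i}a_i)\otimes x_{j_{i+1}}\otimes\cdots\otimes x_{j_n}\otimes a_n .$$ Give $x_j$ the degree $\deg f_j$. Then $\mathrm{Sh}(X|\mathbf{LH}(F),R)$ is a graded complex: its part of degree $p$ is spanned by the tensors $a_0\otimes x_{j_1}\otimes\cdots\otimes x_{j_n}\otimes a_n$ with homogeneous $a_i$ and total degree $p$. And $\mathrm{Sh}(X|F,R)$ is a filtered complex: $F_p\mathrm{Sh}_n(X|F,R)$ is spanned by such tensors of total degree at most $p$. Let $\widetilde{\mathrm{Sh}}(X|F,R)=\bigoplus_pF_p\mathrm{Sh}(X|F,R)$ and $G(\mathrm{Sh})(X|F,R)=\bigoplus_pF_p\mathrm{Sh}(X|F,R)/F_{p-1}\mathrm{Sh}(X|F,R)$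 be the associated Rees complex and associated graded complex, let $\varphi:\mathrm{Sh}(X|\mathbf{LH}(F),R)\to G(\mathrm{Sh})(X|F,R)$ and $\psi:\widetilde{\mathrm{Sh}}(X|F,R)\to G(\mathrm{Sh})(X|F,R)$ be the canonical graded morphisms, and let $\varphi_*$, $\psi_*$ be the induced maps on homology. Put $E_1=\varphi_*^{-1}(\operatorname{Im}\psi_*)\subseteq H_1(\mathrm{Sh}(X|\mathbf{LH}(F),R))$, a graded subspace; its homogeneous elements are called extendable classes. The following statements are equivalent. 1. $\langle\mathbf{LH}(F)\rangle=\langle\mathbf{LH}(I)\rangle$. 2. (Restatement of 1: the general PBW property.) $\phi$ induces an isomorphism of $K$-algebras $\rho:R/\langle\mathbf{LH}(F)\rangle\to G(A)$. 3. $E_1=H_1(\mathrm{Sh}(X|\mathbf{LH}(F),R))$. 4. The $R$-$R$-bimodule $H_1(\mathrm{Sh}(X|\mathbf{LH}(F),R))$ is generated by extendable classes. -/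

import Mathlib

open scoped TensorProduct DirectSum

noncomputable section

namespace PBW

/-! ### Homology and filtrations of modules -/

section Linear

variable {K : Type*} [Field K]

/-- The homology `ker g / im f` of `A --f--> B --g--> C` at `B`. -/
abbrev Homology {A B C : Type*} [AddCommGroup A] [Module K A] [AddCommGroup B] [Module K B]
    [AddCommGroup C] [Module K C] (f : A →ₗ[K] B) (g : B →ₗ[K] C) : Type _ :=
  LinearMap.ker g ⧸ (LinearMap.range f).comap (LinearMap.ker g).subtype

/-- The map induced on homology by a morphism `(α, β, γ)` from `A ⟶ B ⟶ C` to `A' ⟶ B' ⟶ C'`. -/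
def Homology.map {A B C A' B' C' : Type*} [AddCommGroup A] [Module K A] [AddCommGroup B]
    [Module K B] [AddCommGroup C] [Module K C] [AddCommGroup A'] [Module K A'] [AddCommGroup B']
    [Module K B'] [AddCommGroup C'] [Module K C']
    {f : A →ₗ[K] B} {g : B →ₗ[K] C} {f' : A' →ₗ[K] B'} {g' : B' →ₗ[K] C'}
    (α : A →ₗ[K] A') (β : B →ₗ[K] B') (γ : C →ₗ[K] C')
    (h₁ : ∀ x, β (f x) = f' (α x)) (h₂ : ∀ y, γ (g y) = g' (β y)) :
    Homology f g →ₗ[K] Homology f' g' :=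
  Submodule.mapQ _ _
    (β.restrict (p := LinearMap.ker g) (q := LinearMap.ker g') (fun y hy => by
      rw [LinearMap.mem_ker] at hy ⊢
      rw [← h₂, hy, map_zero]))
    (by
      rintro ⟨y, hy⟩ ⟨x, hx⟩
      exact ⟨α x, by rw [← h₁, hx]; rfl⟩)

/-- For a filtration `F₀ ⊆ F₁ ⊆ ⋯`, the term `F_{p-1}`, where `F_{-1} = 0`. -/
def prev {M : Type*} [AddCommGroup M] [Module K M] (F : ℕ → Submodule K M) : ℕ → Submodule K M
  | 0 => ⊥
  | p + 1 => F p

/-- The degree-`p` part `F_p / F_{p-1}` of the associated graded object of a filtration. -/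
def Gr {M : Type*} [AddCommGroup M] [Module K M] (F : ℕ → Submodule K M) (p : ℕ) : Type _ :=
  F p ⧸ (prev F p).comap (F p).subtype

instance {M : Type*} [AddCommGroup M] [Module K M] (F : ℕ → Submodule K M) (p : ℕ) :
    AddCommGroup (Gr F p) :=
  inferInstanceAs (AddCommGroup (F p ⧸ (prev F p).comap (F p).subtype))

instance {M : Type*} [AddCommGroup M] [Module K M] (F : ℕ → Submodule K M) (p : ℕ) :
    Module K (Gr F p) :=
  inferInstanceAs (Module K (F p ⧸ (prev F p).comap (F p).subtype))

/-- The canonical projection `F_p → F_p / F_{p-1}`. -/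
def Gr.proj {M : Type*} [AddCommGroup M] [Module K M] (F : ℕ → Submodule K M) (p : ℕ) :
    F p →ₗ[K] Gr F p :=
  ((prev F p).comap (F p).subtype).mkQ

theorem Gr.proj_eq_iff {M : Type*} [AddCommGroup M] [Module K M] {F : ℕ → Submodule K M}
    {p : ℕ} (x y : F p) : Gr.proj F p x = Gr.proj F p y ↔ (x : M) - y ∈ prev F p :=
  Submodule.Quotient.eq _

/-- The map `F_p / F_{p-1} → F'_p / F'_{p-1}` induced by a filtered homomorphism. -/
def Gr.map {M M' : Type*} [AddCommGroup M] [Module K M] [AddCommGroup M'] [Module K M']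
    {F : ℕ → Submodule K M} {F' : ℕ → Submodule K M'} (g : M →ₗ[K] M')
    (hg : ∀ p, ∀ x ∈ F p, g x ∈ F' p) (p : ℕ) : Gr F p →ₗ[K] Gr F' p :=
  Submodule.mapQ _ _ (g.restrict (hg p)) (by
    rintro ⟨x, hx⟩ h
    cases p with
    | zero =>
      have h0 : x = 0 := h
      subst h0
      exact map_zero g
    | succ p => exact hg p x h)

theorem prev_mono {M : Type*} [AddCommGroup M] [Module K M] {F : ℕ → Submodule K M}
    (hF : Monotone F) : Monotone (prev F) := by
  intro p q hpq
  cases p with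
  | zero => exact bot_le
  | succ p =>
    cases q with
    | zero => omega
    | succ q => exact hF (by omega)

theorem prev_le {M : Type*} [AddCommGroup M] [Module K M] {F : ℕ → Submodule K M}
    (hF : Monotone F) (p : ℕ) : prev F p ≤ F p := by
  cases p with
  | zero => exact bot_le
  | succ p => exact hF (by omega)

theorem le_prev {M : Type*} [AddCommGroup M] [Module K M] {F : ℕ → Submodule K M}
    (hF : Monotone F) {p q : ℕ} (h : q < p) : F q ≤ prev F p := by
  cases p with
  | zero => omega
  | succ p => exact hF (by omega)

end Linear

/-! ### The associated graded algebra of a filtered algebra -/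

section GrAlgebra

variable {K A : Type*} [Field K] [Ring A] [Algebra K A]

/-- An exhaustive `ℕ`-filtration of an algebra by subspaces with `1 ∈ F₀` and
`F_p F_q ⊆ F_{p+q}`. -/
class AlgFiltration (F : ℕ → Submodule K A) : Prop where
  mono : Monotone F
  exhaustive : ∀ a, ∃ p, a ∈ F p
  one_mem : (1 : A) ∈ F 0
  mul_mem : ∀ {p q : ℕ} {a b : A}, a ∈ F p → b ∈ F q → a * b ∈ F (p + q)

variable (F : ℕ → Submodule K A)

/-- The class of `a ∈ F_p` in `F_p / F_{p-1}`. -/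
def Gr.mk (p : ℕ) (a : A) (ha : a ∈ F p) : Gr F p :=
  Gr.proj F p ⟨a, ha⟩

variable {F}

theorem Gr.ind {p : ℕ} {P : Gr F p → Prop} (h : ∀ a ha, P (Gr.mk F p a ha)) (x : Gr F p) : P x :=
  Submodule.Quotient.induction_on _ x fun y => h y.1 y.2

theorem Gr.mk_congr {p q : ℕ} {a b : A} {ha : a ∈ F p} {hb : b ∈ F q} (hpq : p = q) (hab : a = b) :
    (⟨p, Gr.mk F p a ha⟩ : GradedMonoid (Gr F)) = ⟨q, Gr.mk F q b hb⟩ := by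
  subst hpq; subst hab; rfl

theorem Gr.mk_eq {p : ℕ} {a b : A} {ha : a ∈ F p} {hb : b ∈ F p} (hab : a = b) :
    Gr.mk F p a ha = Gr.mk F p b hb := by
  subst hab; rfl

variable (F) [AlgFiltration F]

theorem prev_mul_mem {p q : ℕ} {a b : A} (ha : a ∈ prev F p) (hb : b ∈ F q) :
    a * b ∈ prev F (p + q) := by
  cases p with
  | zero =>
    have : a = 0 := ha
    simp [this]
  | succ p =>
    exact le_prev AlgFiltration.mono (by omega) (AlgFiltration.mul_mem (F := F) (p := p) ha hb)

theorem mul_prev_mem {p q : ℕ} {a b : A} (ha : a ∈ F p) (hb : b ∈ prev F q) :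
    a * b ∈ prev F (p + q) := by
  cases q with
  | zero =>
    have : b = 0 := hb
    simp [this]
  | succ q =>
    exact le_prev AlgFiltration.mono (by omega) (AlgFiltration.mul_mem (F := F) (q := q) ha hb)

/-- Multiplication `(F_p / F_{p-1}) × (F_q / F_{q-1}) → F_{p+q} / F_{p+q-1}`, `[a] [b] = [a b]`. -/
def Gr.mul {p q : ℕ} : Gr F p → Gr F q → Gr F (p + q) :=
  Quotient.map₂ (sa := ((prev F p).comap (F p).subtype).quotientRel)
    (sb := ((prev F q).comap (F q).subtype).quotientRel)
    (sc := ((prev F (p + q)).comap (F (p + q)).subtype).quotientRel) (fun a b => ⟨a.1 * b.1, AlgFiltration.mul_mem a.2 b.2⟩) (by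
    rintro ⟨a, ha⟩ ⟨a', ha'⟩ haa ⟨b, hb⟩ ⟨b', hb'⟩ hbb
    have h₁ : a - a' ∈ prev F p :=
      (Submodule.quotientRel_def ((prev F p).comap (F p).subtype)).1 haa
    have h₂ : b - b' ∈ prev F q :=
      (Submodule.quotientRel_def ((prev F q).comap (F q).subtype)).1 hbb
    refine (Submodule.quotientRel_def _).2 ?_
    change a * b - a' * b' ∈ prev F (p + q)
    have : a * b - a' * b' = (a - a') * b + a' * (b - b') := by noncomm_ring
    rw [this]
    exact add_mem (prev_mul_mem F h₁ hb) (mul_prev_mem F ha' h₂))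

theorem Gr.mk_mul_mk {p q : ℕ} {a b : A} (ha : a ∈ F p) (hb : b ∈ F q) :
    Gr.mul F (Gr.mk F p a ha) (Gr.mk F q b hb) =
      Gr.mk F (p + q) (a * b) (AlgFiltration.mul_mem ha hb) := rfl

theorem natCast_mem (n : ℕ) : (n : A) ∈ F 0 := by
  rw [← nsmul_one]; exact nsmul_mem AlgFiltration.one_mem n

theorem intCast_mem (n : ℤ) : (n : A) ∈ F 0 := by
  rw [← zsmul_one]; exact zsmul_mem AlgFiltration.one_mem n

theorem algebraMap_mem (k : K) : algebraMap K A k ∈ F 0 := by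
  rw [Algebra.algebraMap_eq_smul_one]; exact Submodule.smul_mem _ _ AlgFiltration.one_mem

instance : GradedMonoid.GMul (Gr F) where
  mul := Gr.mul F

instance : GradedMonoid.GOne (Gr F) where
  one := Gr.mk F 0 1 AlgFiltration.one_mem

instance : GradedMonoid.GMonoid (Gr F) where
  one_mul := by
    rintro ⟨p, x⟩
    induction x using Gr.ind with
    | h a ha => exact Gr.mk_congr (zero_add p) (one_mul a)
  mul_one := by
    rintro ⟨p, x⟩
    induction x using Gr.ind with
    | h a ha => exact Gr.mk_congr (add_zero p) (mul_one a)
  mul_assoc := by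
    rintro ⟨p, x⟩ ⟨q, y⟩ ⟨r, z⟩
    induction x using Gr.ind with
    | h a ha =>
    induction y using Gr.ind with
    | h b hb =>
    induction z using Gr.ind with
    | h c hc => exact Gr.mk_congr (add_assoc p q r) (mul_assoc a b c)

/-- The associated graded algebra `⨁ p, F_p / F_{p-1}` is a ring. -/
instance : DirectSum.GRing (Gr F) where
  mul_zero := by
    intro p q x
    induction x using Gr.ind with
    | h a ha => exact Gr.mk_eq (ha := AlgFiltration.mul_mem ha (zero_mem _)) (hb := zero_mem _)
                  (mul_zero a)
  zero_mul := by
    intro p q x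
    induction x using Gr.ind with
    | h a ha => exact Gr.mk_eq (ha := AlgFiltration.mul_mem (zero_mem _) ha) (hb := zero_mem _)
                  (zero_mul a)
  mul_add := by
    intro p q x y z
    induction x using Gr.ind with
    | h a ha =>
    induction y using Gr.ind with
    | h b hb =>
    induction z using Gr.ind with
    | h c hc =>
      exact Gr.mk_eq (ha := AlgFiltration.mul_mem ha (add_mem hb hc))
        (hb := add_mem (AlgFiltration.mul_mem ha hb) (AlgFiltration.mul_mem ha hc)) (mul_add a b c)
  add_mul := by
    intro p q x y z
    induction x using Gr.ind with
    | h a ha =>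
    induction y using Gr.ind with
    | h b hb =>
    induction z using Gr.ind with
    | h c hc =>
      exact Gr.mk_eq (ha := AlgFiltration.mul_mem (add_mem ha hb) hc)
        (hb := add_mem (AlgFiltration.mul_mem ha hc) (AlgFiltration.mul_mem hb hc)) (add_mul a b c)
  natCast n := Gr.mk F 0 n (natCast_mem F n)
  natCast_zero := Gr.mk_eq (hb := zero_mem _) Nat.cast_zero
  natCast_succ n := Gr.mk_eq (hb := add_mem (natCast_mem F n) AlgFiltration.one_mem)
    (Nat.cast_succ n)
  intCast n := Gr.mk F 0 n (intCast_mem F n)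
  intCast_ofNat n := Gr.mk_eq (Int.cast_natCast n)
  intCast_negSucc_ofNat n := Gr.mk_eq (hb := neg_mem (natCast_mem F (n + 1))) (Int.cast_negSucc n)

/-- The associated graded algebra `⨁ p, F_p / F_{p-1}` is a `K`-algebra. -/
instance : DirectSum.GAlgebra K (Gr F) where
  toFun :=
    { toFun := fun k => Gr.mk F 0 (algebraMap K A k) (algebraMap_mem F k)
      map_zero' := Gr.mk_eq (hb := zero_mem _) (map_zero _)
      map_add' := fun k l => Gr.mk_eq (hb := add_mem (algebraMap_mem F k) (algebraMap_mem F l))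
        (map_add _ k l) }
  map_one := Gr.mk_eq (map_one _)
  map_mul k l := Gr.mk_congr (zero_add 0).symm (map_mul _ k l)
  commutes := by
    rintro k ⟨p, x⟩
    induction x using Gr.ind with
    | h a ha => exact Gr.mk_congr (add_comm 0 p) (Algebra.commutes k a)
  smul_def := by
    rintro k ⟨p, x⟩
    induction x using Gr.ind with
    | h a ha => exact Gr.mk_congr (ha := Submodule.smul_mem _ k ha) (zero_add p).symm
                  (Algebra.smul_def k a)

end GrAlgebra

/-! ### Leading homogeneous parts, and the general PBW property -/

section Graded

variable {K R : Type*} [Field K] [Ring R] [Algebra K R] (𝒜 : ℕ → Submodule K R)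

/-- The grading filtration `F_p R = ⨁_{i ≤ p} R_i`. -/
def gradingFil (p : ℕ) : Submodule K R := ⨆ i, ⨆ _ : i ≤ p, 𝒜 i

theorem gradingFil_mono : Monotone (gradingFil 𝒜) := by
  intro p q hpq
  exact iSup₂_le fun i hi => le_iSup₂_of_le i (hi.trans hpq) le_rfl

theorem mem_gradingFil {i p : ℕ} (h : i ≤ p) {a : R} (ha : a ∈ 𝒜 i) : a ∈ gradingFil 𝒜 p :=
  (le_iSup₂_of_le (f := fun i (_ : i ≤ p) => 𝒜 i) i h le_rfl) ha

variable [GradedAlgebra 𝒜]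

open Classical in
/-- The degree of `f ∈ R`: the largest `p` for which the homogeneous component of `f` of degree `p`
is nonzero; by convention the degree of `0` is `0`. -/
def deg (f : R) : ℕ := (DirectSum.decompose 𝒜 f).support.sup id

/-- The leading homogeneous part of `f`: its homogeneous component of degree `deg f`; in
particular the leading homogeneous part of `0` is `0`. -/
def LH (f : R) : R := DirectSum.decompose 𝒜 f (deg 𝒜 f)

instance : AlgFiltration (gradingFil 𝒜) where
  mono := gradingFil_mono 𝒜
  exhaustive a := by
    induction a using DirectSum.Decomposition.inductionOn 𝒜 with
    | zero => exact ⟨0, zero_mem _⟩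
    | @homogeneous i m => exact ⟨i, mem_gradingFil 𝒜 le_rfl m.2⟩
    | add a b ha hb =>
      obtain ⟨p, hp⟩ := ha
      obtain ⟨q, hq⟩ := hb
      exact ⟨max p q, add_mem (gradingFil_mono 𝒜 (le_max_left _ _) hp)
        (gradingFil_mono 𝒜 (le_max_right _ _) hq)⟩
  one_mem := mem_gradingFil 𝒜 le_rfl SetLike.GradedOne.one_mem
  mul_mem := by
    intro p q a b ha hb
    have h : gradingFil 𝒜 p * gradingFil 𝒜 q ≤ gradingFil 𝒜 (p + q) := by
      simp only [gradingFil, Submodule.iSup_mul, Submodule.mul_iSup]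
      refine iSup₂_le fun j hj => iSup₂_le fun i hi => Submodule.mul_le.2 fun a ha b hb => ?_
      exact mem_gradingFil 𝒜 (add_le_add hi hj) (SetLike.GradedMul.mul_mem ha hb)
    exact h (Submodule.mul_mem_mul ha hb)

theorem LH_mem (f : R) : LH 𝒜 f ∈ 𝒜 (deg 𝒜 f) := SetLike.coe_mem _

theorem sub_LH_mem (f : R) : f - LH 𝒜 f ∈ prev (gradingFil 𝒜) (deg 𝒜 f) := by
  classical
  have hle : ∀ i ∈ (DirectSum.decompose 𝒜 f).support, i ≤ deg 𝒜 f := fun i hi => by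
    have h : i ≤ (DirectSum.decompose 𝒜 f).support.sup id := Finset.le_sup (f := id) hi
    refine h.trans (le_of_eq ?_)
    unfold deg
    congr!
  have hsum : f - LH 𝒜 f = ∑ i ∈ (DirectSum.decompose 𝒜 f).support.erase (deg 𝒜 f),
      (DirectSum.decompose 𝒜 f i : R) := by
    by_cases h : deg 𝒜 f ∈ (DirectSum.decompose 𝒜 f).support
    · rw [sub_eq_iff_eq_add, LH, Finset.sum_erase_add _ _ h, DirectSum.sum_support_decompose]
    · rw [Finset.erase_eq_of_notMem h, DirectSum.sum_support_decompose, LH,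
        DFinsupp.notMem_support_iff.1 h]
      simp
  rw [hsum]
  refine sum_mem fun i hi => ?_
  rw [Finset.mem_erase] at hi
  exact le_prev (gradingFil_mono 𝒜) (lt_of_le_of_ne (hle i hi.2) hi.1)
    (mem_gradingFil 𝒜 le_rfl (SetLike.coe_mem _))

theorem mem_gradingFil_deg (f : R) : f ∈ gradingFil 𝒜 (deg 𝒜 f) := by
  have h := add_mem (prev_le (gradingFil_mono 𝒜) _ (sub_LH_mem 𝒜 f))
    (mem_gradingFil 𝒜 le_rfl (LH_mem 𝒜 f))
  rwa [sub_add_cancel] at h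

/-- The quotient filtration `F_p A = (F_p R + I) / I` on `A = R / I`. -/
def quotFil (I : TwoSidedIdeal R) (p : ℕ) : Submodule K (R ⧸ I.asIdeal) :=
  (gradingFil 𝒜 p).map (Ideal.Quotient.mkₐ K I.asIdeal).toLinearMap

instance (I : TwoSidedIdeal R) : AlgFiltration (quotFil 𝒜 I) where
  mono p q hpq := Submodule.map_mono (gradingFil_mono 𝒜 hpq)
  exhaustive a := by
    obtain ⟨r, rfl⟩ := Ideal.Quotient.mkₐ_surjective K I.asIdeal a
    obtain ⟨p, hp⟩ := AlgFiltration.exhaustive (F := gradingFil 𝒜) r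
    exact ⟨p, r, hp, rfl⟩
  one_mem := ⟨1, AlgFiltration.one_mem, map_one (Ideal.Quotient.mkₐ K I.asIdeal)⟩
  mul_mem := by
    rintro p q _ _ ⟨a, ha, rfl⟩ ⟨b, hb, rfl⟩
    exact ⟨a * b, AlgFiltration.mul_mem ha hb, map_mul (Ideal.Quotient.mkₐ K I.asIdeal) a b⟩

/-- The associated graded algebra `G(A)` of `A = R / I` with respect to the quotient filtration. -/
abbrev GrQuot (I : TwoSidedIdeal R) : Type _ := ⨁ p, Gr (quotFil 𝒜 I) p

/-- The natural graded map `φ : R → G(R / I)`, sending `r ∈ R_p` to the class of `r + I` in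
`F_p A / F_{p-1} A`. -/
def natGr (I : TwoSidedIdeal R) : R →ₗ[K] GrQuot 𝒜 I :=
  DirectSum.toModule K ℕ (GrQuot 𝒜 I) (fun p =>
    DirectSum.lof K ℕ (fun p => Gr (quotFil 𝒜 I) p) p ∘ₗ
      Gr.proj (quotFil 𝒜 I) p ∘ₗ
        (Ideal.Quotient.mkₐ K I.asIdeal).toLinearMap.restrict
          (fun _ hr => Submodule.mem_map_of_mem (mem_gradingFil 𝒜 le_rfl hr))) ∘ₗ
    (DirectSum.decomposeLinearEquiv 𝒜).toLinearMap

end Graded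

/-! ### The Shafarevich complex -/

section Shafarevich

variable (K R J : Type*) [Field K] [Ring R] [Algebra K R]

/-- With `U` the `K`-vector space with basis `X = {x_j}_{j ∈ J}`, the module
`Sh_n = R ⊗ U ⊗ R ⊗ ⋯ ⊗ U ⊗ R` with `n` factors `U` and `n + 1` factors `R`, all tensor products
over `K`. As `U` has basis `X`, this is the direct sum of copies of `R^{⊗ (n + 1)}` indexed by the
words `x_{j_1} ⋯ x_{j_n}`. -/
abbrev Sh (n : ℕ) : Type _ := (Fin n → J) →₀ ⨂[K] (_ : Fin (n + 1)), R

variable {R J}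

/-- The elementary tensor `a_0 ⊗ x_{w_0} ⊗ a_1 ⊗ ⋯ ⊗ a_{n-1} ⊗ x_{w_{n-1}} ⊗ a_n` in `Sh_n`. -/
def Sh.tensor {n : ℕ} (w : Fin n → J) (a : Fin (n + 1) → R) : Sh K R J n :=
  Finsupp.single w (PiTensorProduct.tprod K a)

variable {K}

theorem Sh.ind {n : ℕ} {P : Sh K R J n → Prop} (zero : P 0)
    (tensor : ∀ w a, P (Sh.tensor K w a)) (smul : ∀ (k : K) z, P z → P (k • z))
    (add : ∀ y z, P y → P z → P (y + z)) (z : Sh K R J n) : P z := by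
  induction z using Finsupp.induction_linear with
  | zero => exact zero
  | add y z hy hz => exact add y z hy hz
  | single w t =>
    induction t using PiTensorProduct.induction_on with
    | smul_tprod k a => simpa [Sh.tensor] using smul k _ (tensor w a)
    | add s t hs ht => rw [Finsupp.single_add]; exact add _ _ hs ht

/-- From `(a_0, …, a_{n+1})` form `(a_0, …, a_{i-1}, a_i c a_{i+1}, a_{i+2}, …, a_{n+1})`. -/
def contract {n : ℕ} (c : R) (i : Fin (n + 1)) (a : Fin (n + 2) → R) : Fin (n + 1) → R := fun k =>
  if k < i then a k.castSucc else if k = i then a i.castSucc * c * a i.succ else a k.succ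

theorem contract_self {n : ℕ} (c : R) (i : Fin (n + 1)) (a : Fin (n + 2) → R) :
    contract c i a i = a i.castSucc * c * a i.succ := by
  simp [contract]

theorem contract_ne {n : ℕ} (c : R) {i k : Fin (n + 1)} (h : k ≠ i) (a : Fin (n + 2) → R) :
    contract c i a k = a (i.castSucc.succAbove k) := by
  unfold contract
  rcases lt_or_gt_of_ne h with h' | h'
  · rw [if_pos h', Fin.succAbove_of_castSucc_lt _ _ (by simpa using h')]
  · rw [if_neg h'.not_gt, if_neg h, Fin.succAbove_of_le_castSucc _ _ (by simpa using h'.le)]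

theorem contract_update {n : ℕ} (c : R) (i : Fin (n + 1)) (a : Fin (n + 2) → R)
    (m : Fin (n + 2)) : ∃ (k : Fin (n + 1)) (g : R →ₗ[K] R), ∀ x,
      contract c i (Function.update a m x) = Function.update (contract c i a) k (g x) := by
  have key : ∀ k : Fin (n + 1), k ≠ i → i.castSucc.succAbove k ≠ i.castSucc ∧
      i.castSucc.succAbove k ≠ i.succ := fun k hk => by
    refine ⟨Fin.succAbove_ne _ _, fun h => hk ?_⟩
    rw [← Fin.succAbove_castSucc_self] at h
    exact Fin.succAbove_right_injective h
  have hne : i.castSucc ≠ i.succ := (Fin.castSucc_lt_succ).ne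
  by_cases hm : m = i.castSucc
  · subst hm
    refine ⟨i, LinearMap.mulRight K (c * a i.succ), fun x => funext fun k => ?_⟩
    by_cases hk : k = i
    · subst hk
      simp [contract_self, hne.symm, mul_assoc]
    · simp [contract_ne c hk, hk]
  by_cases hm' : m = i.succ
  · subst hm'
    refine ⟨i, LinearMap.mulLeft K (a i.castSucc * c), fun x => funext fun k => ?_⟩
    by_cases hk : k = i
    · subst hk
      simp [contract_self, hne, mul_assoc]
    · simp [contract_ne c hk, hk, (key k hk).2]
  obtain ⟨l, rfl⟩ := Fin.exists_succAbove_eq hm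
  have hl : l ≠ i := fun h => hm' (by rw [h, Fin.succAbove_castSucc_self])
  refine ⟨l, LinearMap.id, fun x => funext fun k => ?_⟩
  by_cases hk : k = i
  · subst hk
    simp [contract_self, hl.symm, (key l hl).1.symm, (key l hl).2.symm]
  · by_cases hkl : k = l
    · subst hkl
      simp [contract_ne c hk]
    · simp [contract_ne c hk, hkl]

variable (K)

/-- The linear map `a_0 ⊗ ⋯ ⊗ a_{n+1} ↦ a_0 ⊗ ⋯ ⊗ (a_i c a_{i+1}) ⊗ ⋯ ⊗ a_{n+1}`. -/
def contractMap {n : ℕ} (c : R) (i : Fin (n + 1)) :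
    (⨂[K] (_ : Fin (n + 2)), R) →ₗ[K] ⨂[K] (_ : Fin (n + 1)), R :=
  PiTensorProduct.lift
    (MultilinearMap.mk' (fun a => PiTensorProduct.tprod K (contract c i a))
      (fun a m x y => by
        obtain ⟨k, g, h⟩ := contract_update (K := K) c i a m
        simp only [h, map_add, MultilinearMap.map_update_add])
      (fun a m r x => by
        obtain ⟨k, g, h⟩ := contract_update (K := K) c i a m
        simp only [h, map_smul, MultilinearMap.map_update_smul]))

/-- The differential `d_{n+1} : Sh_{n+1} → Sh_n` of the Shafarevich complex `Sh(X | c, R)` of a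
family `c = {c_j}_{j ∈ J}` in `R`:
`d(a_0 ⊗ x_{w_0} ⊗ a_1 ⊗ ⋯ ⊗ x_{w_n} ⊗ a_{n+1}) =
  ∑ i, (-1)^i a_0 ⊗ x_{w_0} ⊗ ⋯ ⊗ (a_i c_{w_i} a_{i+1}) ⊗ ⋯ ⊗ x_{w_n} ⊗ a_{n+1}`,
the letter `x_{w_i}` being removed in the `i`-th summand, `0 ≤ i ≤ n`. -/
def shD (c : J → R) (n : ℕ) : Sh K R J (n + 1) →ₗ[K] Sh K R J n :=
  Finsupp.lsum K fun w => ∑ i : Fin (n + 1),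
    (-1 : K) ^ (i : ℕ) • (Finsupp.lsingle (i.removeNth w) ∘ₗ contractMap K (c (w i)) i)

variable {K}

theorem shD_tensor (c : J → R) {n : ℕ} (w : Fin (n + 1) → J) (a : Fin (n + 2) → R) :
    shD K c n (Sh.tensor K w a) = ∑ i : Fin (n + 1),
      (-1 : K) ^ (i : ℕ) • Sh.tensor K (i.removeNth w) (contract (c (w i)) i a) := by
  simp [shD, Sh.tensor, contractMap]

theorem contract_contract {n : ℕ} (c c' : R) {i j : Fin (n + 1)} (h : i ≤ j)
    (a : Fin (n + 3) → R) :
    contract c' j (contract c i.castSucc a) = contract c i (contract c' j.succ a) := by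
  funext k
  simp only [contract, Fin.lt_def, Fin.ext_iff, Fin.le_def, Fin.val_castSucc, Fin.val_succ] at h ⊢
  split_ifs <;> first | omega | rfl | skip
  obtain rfl : i = j := Fin.ext (by omega)
  simp only [mul_assoc, Fin.succ_castSucc]

theorem removeNth_removeNth {n : ℕ} {i j : Fin (n + 1)} (h : i ≤ j) (w : Fin (n + 2) → J) :
    j.removeNth (i.castSucc.removeNth w) = i.removeNth (j.succ.removeNth w) := by
  funext k
  simp only [Fin.removeNth]
  congr 1
  simp only [Fin.succAbove, Fin.lt_def, Fin.ext_iff, Fin.le_def] at h ⊢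
  split_ifs <;> simp_all <;> omega

/-- The Shafarevich complex is a complex. -/
theorem shD_shD (c : J → R) (n : ℕ) (z : Sh K R J (n + 2)) :
    shD K c n (shD K c (n + 1) z) = 0 := by
  induction z using Sh.ind with
  | zero => simp
  | smul k z h => simp [h]
  | add y z hy hz => simp [hy, hz]
  | tensor w a =>
    simp only [shD_tensor, map_sum, map_smul, Finset.smul_sum, smul_smul, ← pow_add]
    rw [← Finset.sum_product', Finset.univ_product_univ]
    let S : Finset (Fin (n + 2) × Fin (n + 1)) :=
      {ij : Fin (n + 2) × Fin (n + 1) | (ij.1 : ℕ) ≤ (ij.2 : ℕ)}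
    rw [← Finset.sum_add_sum_compl S, ← eq_neg_iff_add_eq_zero, ← Finset.sum_neg_distrib]
    let φ : ∀ ij : Fin (n + 2) × Fin (n + 1), ij ∈ S → Fin (n + 2) × Fin (n + 1) := fun ij hij =>
      (ij.2.succ, Fin.castLT ij.1 (lt_of_le_of_lt (Finset.mem_filter.mp hij).right ij.2.is_lt))
    apply Finset.sum_bij φ
    · intro ij hij
      simp only [S, φ, Finset.compl_filter, Finset.mem_filter_univ, Fin.val_succ,
        Fin.val_castLT] at hij ⊢
      omega
    · rintro ⟨i, j⟩ hij ⟨i', j'⟩ hij' h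
      simp only [φ, Prod.mk.injEq, Fin.ext_iff, Fin.val_succ, Fin.val_castLT] at h ⊢
      omega
    · rintro ⟨i', j'⟩ hij'
      simp only [S, Finset.compl_filter, Finset.mem_filter_univ, not_le] at hij'
      have hi : i' ≠ 0 := by rintro rfl; simp at hij'
      refine ⟨(j'.castSucc, i'.pred hi), ?_, ?_⟩
      · simp only [S, Finset.mem_filter_univ, Fin.val_castSucc, Fin.val_pred]
        omega
      · simp [φ]
    · rintro ⟨i, j⟩ hij
      simp only [S, Finset.mem_filter_univ] at hij
      obtain ⟨i, rfl⟩ : ∃ i' : Fin (n + 1), i = i'.castSucc :=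
        ⟨i.castLT (by omega), by simp⟩
      have hij' : i ≤ j := hij
      have e1 : i.castSucc.removeNth w j = w j.succ := by
        simp [Fin.removeNth, Fin.succAbove_of_le_castSucc _ _ (Fin.castSucc_le_castSucc_iff.2 hij')]
      have e2 : j.succ.removeNth w i = w i.castSucc := by
        simp [Fin.removeNth, Fin.succAbove_of_castSucc_lt _ _
          (lt_of_le_of_lt (Fin.castSucc_le_castSucc_iff.2 hij') Fin.castSucc_lt_succ)]
      simp only [φ, Fin.castLT_castSucc, e1, e2, removeNth_removeNth hij', contract_contract _ _ hij',
        Fin.val_castSucc, Fin.val_succ, ← neg_smul]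
      congr 1
      ring

/-! #### The bimodule structure -/

variable (K J)

/-- Left multiplication by `r ∈ R` on `Sh_n`. -/
def shLeft (r : R) (n : ℕ) : Sh K R J n →ₗ[K] Sh K R J n :=
  Finsupp.mapRange.linearMap
    (PiTensorProduct.map fun k => if k = 0 then LinearMap.mulLeft K r else LinearMap.id)

/-- Right multiplication by `r ∈ R` on `Sh_n`. -/
def shRight (r : R) (n : ℕ) : Sh K R J n →ₗ[K] Sh K R J n :=
  Finsupp.mapRange.linearMap
    (PiTensorProduct.map fun k => if k = Fin.last n then LinearMap.mulRight K r else LinearMap.id)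

variable {K J}

theorem shLeft_tensor (r : R) {n : ℕ} (w : Fin n → J) (a : Fin (n + 1) → R) :
    shLeft K J r n (Sh.tensor K w a) = Sh.tensor K w (Function.update a 0 (r * a 0)) := by
  simp only [shLeft, Sh.tensor, Finsupp.mapRange.linearMap_apply, Finsupp.mapRange_single,
    PiTensorProduct.map_tprod]
  congr 2
  funext k
  by_cases h : k = 0
  · subst h; simp
  · simp [h]

theorem shRight_tensor (r : R) {n : ℕ} (w : Fin n → J) (a : Fin (n + 1) → R) :
    shRight K J r n (Sh.tensor K w a) =
      Sh.tensor K w (Function.update a (Fin.last n) (a (Fin.last n) * r)) := by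
  simp only [shRight, Sh.tensor, Finsupp.mapRange.linearMap_apply, Finsupp.mapRange_single,
    PiTensorProduct.map_tprod]
  congr 2
  funext k
  by_cases h : k = Fin.last n
  · subst h; simp
  · simp [h]

theorem contract_update_zero {n : ℕ} (c r : R) (i : Fin (n + 1)) (a : Fin (n + 2) → R) :
    contract c i (Function.update a 0 (r * a 0)) =
      Function.update (contract c i a) 0 (r * contract c i a 0) := by
  funext k
  by_cases hk : k = i
  · subst hk
    rw [contract_self]
    by_cases h0 : k = 0
    · subst h0
      simp [contract_self, mul_assoc]
    · simp [h0, contract_self]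
  · rw [contract_ne c hk]
    by_cases h0 : k = 0
    · subst h0
      have : i.castSucc.succAbove 0 = 0 := Fin.succAbove_ne_zero_zero (by simpa using Ne.symm hk)
      simp [this, contract_ne c hk]
    · have : i.castSucc.succAbove k ≠ 0 := by
        rcases eq_or_ne i 0 with rfl | hi
        · exact Fin.succAbove_ne _ _
        · exact Fin.succAbove_ne_zero (by simpa using hi) h0
      simp [this, h0, contract_ne c hk]

theorem contract_update_last {n : ℕ} (c r : R) (i : Fin (n + 1)) (a : Fin (n + 2) → R) :
    contract c i (Function.update a (Fin.last (n + 1)) (a (Fin.last (n + 1)) * r)) =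
      Function.update (contract c i a) (Fin.last n) (contract c i a (Fin.last n) * r) := by
  funext k
  by_cases hk : k = i
  · subst hk
    rw [contract_self]
    have h1 : k.castSucc ≠ Fin.last (n + 1) := (Fin.castSucc_lt_last k).ne
    by_cases h0 : k = Fin.last n
    · subst h0
      simp [contract_self, mul_assoc, h1]
    · have h2 : k.succ ≠ Fin.last (n + 1) := by simpa [← Fin.succ_last] using h0
      simp [h0, contract_self, h1, h2]
  · rw [contract_ne c hk]
    by_cases h0 : k = Fin.last n
    · subst h0
      have : i.castSucc.succAbove (Fin.last n) = Fin.last (n + 1) :=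
        Fin.succAbove_ne_last_last (Fin.castSucc_lt_last i).ne
      simp [this, contract_ne c hk]
    · have : i.castSucc.succAbove k ≠ Fin.last (n + 1) :=
        Fin.succAbove_ne_last (Fin.castSucc_lt_last i).ne h0
      simp [this, h0, contract_ne c hk]

theorem shD_shLeft (c : J → R) (r : R) (n : ℕ) (z : Sh K R J (n + 1)) :
    shLeft K J r n (shD K c n z) = shD K c n (shLeft K J r (n + 1) z) := by
  induction z using Sh.ind with
  | zero => simp
  | tensor w a => simp only [shD_tensor, shLeft_tensor, map_sum, map_smul, contract_update_zero]
  | smul k z h => simp only [map_smul, h]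
  | add y z hy hz => simp only [map_add, hy, hz]

theorem shD_shRight (c : J → R) (r : R) (n : ℕ) (z : Sh K R J (n + 1)) :
    shRight K J r n (shD K c n z) = shD K c n (shRight K J r (n + 1) z) := by
  induction z using Sh.ind with
  | zero => simp
  | tensor w a => simp only [shD_tensor, shRight_tensor, map_sum, map_smul, contract_update_last]
  | smul k z h => simp only [map_smul, h]
  | add y z hy hz => simp only [map_add, hy, hz]

/-! #### Gradings and filtrations -/

section Degrees

variable (𝒜 : ℕ → Submodule K R) (e : J → ℕ)

/-- When `x_j` is given the degree `e_j`, the homogeneous part of degree `p` of `Sh_n`: the span of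
the elementary tensors with homogeneous entries `a_0, …, a_n` and letters `x_{w_0}, …, x_{w_{n-1}}`
whose degrees add up to `p`. -/
def shDeg (n p : ℕ) : Submodule K (Sh K R J n) :=
  Submodule.span K {z | ∃ (w : Fin n → J) (a : Fin (n + 1) → R) (q : Fin (n + 1) → ℕ),
    (∀ i, a i ∈ 𝒜 (q i)) ∧ ∑ i, q i + ∑ i, e (w i) = p ∧ z = Sh.tensor K w a}

/-- When `x_j` is given the degree `e_j`, the filtration term `F_p Sh_n`: the span of the
elementary tensors with homogeneous entries `a_0, …, a_n` and letters `x_{w_0}, …, x_{w_{n-1}}`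
whose degrees add up to at most `p`. -/
def shFil (n p : ℕ) : Submodule K (Sh K R J n) :=
  Submodule.span K {z | ∃ (w : Fin n → J) (a : Fin (n + 1) → R) (q : Fin (n + 1) → ℕ),
    (∀ i, a i ∈ 𝒜 (q i)) ∧ ∑ i, q i + ∑ i, e (w i) ≤ p ∧ z = Sh.tensor K w a}

theorem shFil_mono (n : ℕ) : Monotone (shFil 𝒜 e n) := by
  intro p q hpq
  refine Submodule.span_mono ?_
  rintro z ⟨w, a, d, ha, hd, rfl⟩
  exact ⟨w, a, d, ha, hd.trans hpq, rfl⟩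

theorem shDeg_le_shFil (n p : ℕ) : shDeg 𝒜 e n p ≤ shFil 𝒜 e n p := by
  refine Submodule.span_mono ?_
  rintro z ⟨w, a, d, ha, hd, rfl⟩
  exact ⟨w, a, d, ha, hd.le, rfl⟩

theorem sum_removeNth {n : ℕ} (i : Fin (n + 1)) (w : Fin (n + 1) → J) :
    ∑ k, e (w k) = e (w i) + ∑ k, e (i.removeNth w k) :=
  Fin.sum_univ_succAbove _ i

variable [GradedAlgebra 𝒜]

theorem contract_mem {n s : ℕ} {c : R} (hc : c ∈ 𝒜 s) (i : Fin (n + 1)) {a : Fin (n + 2) → R}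
    {q : Fin (n + 2) → ℕ} (ha : ∀ k, a k ∈ 𝒜 (q k)) :
    ∃ q' : Fin (n + 1) → ℕ, (∀ k, contract c i a k ∈ 𝒜 (q' k)) ∧ ∑ k, q' k = ∑ k, q k + s := by
  refine ⟨fun k => if k = i then q i.castSucc + s + q i.succ else q (i.castSucc.succAbove k),
    fun k => ?_, ?_⟩
  · by_cases hk : k = i
    · subst hk
      simpa [contract_self] using
        SetLike.mul_mem_graded (SetLike.mul_mem_graded (ha k.castSucc) hc) (ha k.succ)
    · simpa [contract_ne c hk, hk] using ha _
  · rw [Fin.sum_univ_succAbove _ i, Fin.sum_univ_succAbove q i.castSucc,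
      Fin.sum_univ_succAbove (fun k => q (i.castSucc.succAbove k)) i]
    simp only [if_true, Fin.succAbove_ne, if_false, Fin.succAbove_castSucc_self]
    ring

theorem shD_mem_shDeg {c : J → R} (hc : ∀ j, c j ∈ 𝒜 (e j)) (n p : ℕ) :
    ∀ z ∈ shDeg 𝒜 e (n + 1) p, shD K c n z ∈ shDeg 𝒜 e n p := by
  intro z hz
  refine (Submodule.span_le (p := (shDeg 𝒜 e n p).comap (shD K c n))).2 ?_ hz
  rintro _ ⟨w, a, q, ha, hq, rfl⟩
  rw [SetLike.mem_coe, Submodule.mem_comap, shD_tensor]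
  refine sum_mem fun i _ => Submodule.smul_mem _ _ ?_
  obtain ⟨q', hq', hs⟩ := contract_mem 𝒜 (hc (w i)) i ha
  refine Submodule.subset_span ⟨_, _, q', hq', ?_, rfl⟩
  rw [sum_removeNth e i w] at hq
  have hq₂ : ∑ k : Fin (n + 2), q k + (e (w i) + ∑ k, e (i.removeNth w k)) = p := hq
  omega

theorem tensor_contract_mem {n s p : ℕ} {c : R} (hc : c ∈ gradingFil 𝒜 s) (i : Fin (n + 1))
    {a : Fin (n + 2) → R} {q : Fin (n + 2) → ℕ} (ha : ∀ k, a k ∈ 𝒜 (q k)) (w : Fin n → J)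
    (h : ∑ k, q k + s + ∑ k, e (w k) ≤ p) : Sh.tensor K w (contract c i a) ∈ shFil 𝒜 e n p := by
  let L : R →ₗ[K] Sh K R J n := Finsupp.lsingle w ∘ₗ
    (PiTensorProduct.tprod K).toLinearMap (contract 0 i a) i ∘ₗ
      LinearMap.mulRight K (a i.succ) ∘ₗ LinearMap.mulLeft K (a i.castSucc)
  have hL : ∀ c, L c = Sh.tensor K w (contract c i a) := fun c => by
    simp only [L, Sh.tensor, LinearMap.comp_apply, MultilinearMap.toLinearMap_apply,
      Finsupp.lsingle_apply, LinearMap.mulRight_apply, LinearMap.mulLeft_apply]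
    congr 2
    funext k
    by_cases hk : k = i
    · subst hk; simp [contract_self]
    · simp [hk, contract_ne _ hk]
  rw [← hL]
  refine (iSup₂_le (a := (shFil 𝒜 e n p).comap L) fun l hl x hx => ?_ :
    gradingFil 𝒜 s ≤ (shFil 𝒜 e n p).comap L) hc
  rw [Submodule.mem_comap, hL]
  obtain ⟨q', hq', hs⟩ := contract_mem 𝒜 hx i ha
  exact Submodule.subset_span ⟨_, _, q', hq', by omega, rfl⟩

theorem tensor_contract_mem_prev {n s p : ℕ} {c : R} (hc : c ∈ prev (gradingFil 𝒜) s)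
    (i : Fin (n + 1)) {a : Fin (n + 2) → R} {q : Fin (n + 2) → ℕ} (ha : ∀ k, a k ∈ 𝒜 (q k))
    (w : Fin n → J) (h : ∑ k, q k + s + ∑ k, e (w k) ≤ p) :
    Sh.tensor K w (contract c i a) ∈ prev (shFil 𝒜 e n) p := by
  cases s with
  | zero =>
    have hc0 : c = 0 := hc
    have : PiTensorProduct.tprod K (contract c i a) = 0 :=
      (PiTensorProduct.tprod K).map_coord_zero i (by simp [contract_self, hc0])
    simp [Sh.tensor, this]
  | succ s =>
    cases p with
    | zero => omega
    | succ p => exact tensor_contract_mem 𝒜 e (s := s) (p := p) hc i ha w (by omega)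

theorem shD_mem_shFil {c : J → R} (hc : ∀ j, c j ∈ gradingFil 𝒜 (e j)) (n p : ℕ) :
    ∀ z ∈ shFil 𝒜 e (n + 1) p, shD K c n z ∈ shFil 𝒜 e n p := by
  intro z hz
  refine (Submodule.span_le (p := (shFil 𝒜 e n p).comap (shD K c n))).2 ?_ hz
  rintro _ ⟨w, a, q, ha, hq, rfl⟩
  rw [SetLike.mem_coe, Submodule.mem_comap, shD_tensor]
  refine sum_mem fun i _ => Submodule.smul_mem _ _ ?_
  rw [sum_removeNth e i w] at hq
  have hq₂ : ∑ k : Fin (n + 2), q k + (e (w i) + ∑ k, e (i.removeNth w k)) ≤ p := hq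
  exact tensor_contract_mem 𝒜 e (hc (w i)) i ha _ (by omega)

theorem contract_sub_tensor {n : ℕ} (c c' : R) (i : Fin (n + 1)) (a : Fin (n + 2) → R)
    (w : Fin n → J) : Sh.tensor K w (contract c i a) - Sh.tensor K w (contract c' i a) =
      Sh.tensor K w (contract (c - c') i a) := by
  have h : ∀ c, contract c i a =
      Function.update (contract 0 i a) i (a i.castSucc * c * a i.succ) := fun c => by
    funext k
    by_cases hk : k = i
    · subst hk; simp [contract_self]
    · simp [hk, contract_ne _ hk]
  rw [h c, h c', h (c - c'), mul_sub, sub_mul]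
  simp only [Sh.tensor, MultilinearMap.map_update_sub, Finsupp.single_sub]

theorem shD_sub_mem {c c' : J → R} (hc : ∀ j, c j - c' j ∈ prev (gradingFil 𝒜) (e j)) (n p : ℕ) :
    ∀ z ∈ shFil 𝒜 e (n + 1) p, shD K c n z - shD K c' n z ∈ prev (shFil 𝒜 e n) p := by
  intro z hz
  refine (Submodule.span_le
    (p := (prev (shFil 𝒜 e n) p).comap (shD K c n - shD K c' n))).2 ?_ hz
  rintro _ ⟨w, a, q, ha, hq, rfl⟩
  rw [SetLike.mem_coe, Submodule.mem_comap, LinearMap.sub_apply, shD_tensor, shD_tensor,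
    ← Finset.sum_sub_distrib]
  refine sum_mem fun i _ => ?_
  rw [← smul_sub, contract_sub_tensor]
  refine Submodule.smul_mem _ _ ?_
  rw [sum_removeNth e i w] at hq
  have hq₂ : ∑ k : Fin (n + 2), q k + (e (w i) + ∑ k, e (i.removeNth w k)) ≤ p := hq
  exact tensor_contract_mem_prev 𝒜 e (hc (w i)) i ha _ (by omega)

end Degrees

/-! #### Homology and extendable classes -/

section Extendable

variable (𝒜 : ℕ → Submodule K R) [GradedAlgebra 𝒜] (f : J → R)

/-- The degrees of the letters: `deg x_j = deg f_j = deg LH(f_j)`. -/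
abbrev degs : J → ℕ := fun j => deg 𝒜 (f j)

/-- The family `LH(F) = {LH(f_j)}_{j ∈ J}`. -/
abbrev LHs : J → R := fun j => LH 𝒜 (f j)

/-- The homology `H_{n+1}(Sh(X | c, R))`. -/
abbrev shHomology (c : J → R) (n : ℕ) : Type _ := Homology (shD K c (n + 1)) (shD K c n)

/-- Left multiplication by `r ∈ R` on `H_{n+1}(Sh(X | c, R))`. -/
def homologyLeft (c : J → R) (n : ℕ) (r : R) :
    shHomology (K := K) c n →ₗ[K] shHomology (K := K) c n :=
  Homology.map (shLeft K J r (n + 2)) (shLeft K J r (n + 1)) (shLeft K J r n)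
    (shD_shLeft c r (n + 1)) (shD_shLeft c r n)

/-- Right multiplication by `r ∈ R` on `H_{n+1}(Sh(X | c, R))`. -/
def homologyRight (c : J → R) (n : ℕ) (r : R) :
    shHomology (K := K) c n →ₗ[K] shHomology (K := K) c n :=
  Homology.map (shRight K J r (n + 2)) (shRight K J r (n + 1)) (shRight K J r n)
    (shD_shRight c r (n + 1)) (shD_shRight c r n)

/-- The sub-bimodule of `H_{n+1}(Sh(X | c, R))` generated by a set `S`: the smallest subspace that
contains `S` and is stable under left and right multiplication by the elements of `R`. -/
def bimoduleSpan (c : J → R) (n : ℕ) (S : Set (shHomology (K := K) c n)) :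
    Submodule K (shHomology (K := K) c n) :=
  sInf {N | S ⊆ N ∧ ∀ r : R, ∀ h ∈ N, homologyLeft c n r h ∈ N ∧ homologyRight c n r h ∈ N}

/-- The differential of the graded complex `Sh(X | LH(F), R)` in degree `p`,
`Sh_{n+1}(X | LH(F), R)_p → Sh_n(X | LH(F), R)_p`. -/
def leadD (n p : ℕ) :
    shDeg 𝒜 (degs 𝒜 f) (n + 1) p →ₗ[K] shDeg 𝒜 (degs 𝒜 f) n p :=
  (shD K (LHs 𝒜 f) n).restrict (shD_mem_shDeg 𝒜 _ (fun j => LH_mem 𝒜 (f j)) n p)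

theorem shD_filtered (n p : ℕ) : ∀ z ∈ shFil 𝒜 (degs 𝒜 f) (n + 1) p,
    shD K f n z ∈ shFil 𝒜 (degs 𝒜 f) n p :=
  shD_mem_shFil 𝒜 _ (fun j => mem_gradingFil_deg 𝒜 (f j)) n p

/-- The differential of the Rees complex of the filtered complex `Sh(X | F, R)` in degree `p`,
`F_p Sh_{n+1}(X | F, R) → F_p Sh_n(X | F, R)`. -/
def reesD (n p : ℕ) :
    shFil 𝒜 (degs 𝒜 f) (n + 1) p →ₗ[K] shFil 𝒜 (degs 𝒜 f) n p :=
  (shD K f n).restrict (shD_filtered 𝒜 f n p)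

/-- The differential of the associated graded complex of the filtered complex `Sh(X | F, R)` in
degree `p`. -/
def grD (n p : ℕ) :
    Gr (shFil 𝒜 (degs 𝒜 f) (n + 1)) p →ₗ[K] Gr (shFil 𝒜 (degs 𝒜 f) n) p :=
  Gr.map (shD K f n) (shD_filtered 𝒜 f n) p

/-- The natural map `φ : Sh_n(X | LH(F), R)_p → F_p Sh_n(X | F, R) / F_{p-1} Sh_n(X | F, R)`. -/
def phi (n p : ℕ) :
    shDeg 𝒜 (degs 𝒜 f) n p →ₗ[K] Gr (shFil 𝒜 (degs 𝒜 f) n) p :=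
  Gr.proj _ p ∘ₗ Submodule.inclusion (shDeg_le_shFil 𝒜 _ n p)

/-- The canonical map `ψ : F_p Sh_n(X | F, R) → F_p Sh_n(X | F, R) / F_{p-1} Sh_n(X | F, R)`. -/
def psi (n p : ℕ) :
    shFil 𝒜 (degs 𝒜 f) n p →ₗ[K] Gr (shFil 𝒜 (degs 𝒜 f) n) p :=
  Gr.proj _ p

theorem phi_comm (n p : ℕ) (z : shDeg 𝒜 (degs 𝒜 f) (n + 1) p) :
    phi 𝒜 f n p (leadD 𝒜 f n p z) = grD 𝒜 f n p (phi 𝒜 f (n + 1) p z) := by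
  have h := shD_sub_mem 𝒜 (degs 𝒜 f) (c := f) (c' := LHs 𝒜 f)
    (fun j => sub_LH_mem 𝒜 (f j)) n p z (shDeg_le_shFil 𝒜 _ (n + 1) p z.2)
  exact ((Gr.proj_eq_iff (F := shFil 𝒜 (degs 𝒜 f) n)
    ⟨shD K f n z, shD_filtered 𝒜 f n p z (shDeg_le_shFil 𝒜 _ (n + 1) p z.2)⟩
    ⟨shD K (LHs 𝒜 f) n z, shDeg_le_shFil 𝒜 _ n p (leadD 𝒜 f n p z).2⟩).2 h).symm

theorem psi_comm (n p : ℕ) (z : shFil 𝒜 (degs 𝒜 f) (n + 1) p) :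
    psi 𝒜 f n p (reesD 𝒜 f n p z) = grD 𝒜 f n p (psi 𝒜 f (n + 1) p z) := rfl

/-- The degree-`p` part of `H_{n+1}(Sh(X | LH(F), R))`. -/
abbrev leadHomology (n p : ℕ) : Type _ :=
  Homology (K := K) (A := shDeg 𝒜 (degs 𝒜 f) (n + 2) p) (B := shDeg 𝒜 (degs 𝒜 f) (n + 1) p)
    (C := shDeg 𝒜 (degs 𝒜 f) n p) (leadD 𝒜 f (n + 1) p) (leadD 𝒜 f n p)

/-- The degree-`p` part of `H_{n+1}` of the Rees complex of `Sh(X | F, R)`. -/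
abbrev reesHomology (n p : ℕ) : Type _ :=
  Homology (K := K) (A := shFil 𝒜 (degs 𝒜 f) (n + 2) p) (B := shFil 𝒜 (degs 𝒜 f) (n + 1) p)
    (C := shFil 𝒜 (degs 𝒜 f) n p) (reesD 𝒜 f (n + 1) p) (reesD 𝒜 f n p)

/-- The degree-`p` part of `H_{n+1}` of the associated graded complex of `Sh(X | F, R)`. -/
abbrev grHomology (n p : ℕ) : Type _ :=
  Homology (grD 𝒜 f (n + 1) p) (grD 𝒜 f n p)

/-- The degree-`p` part of `φ_*`, on `H_{n+1}`. -/
def phiStar (n p : ℕ) :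
    leadHomology 𝒜 f n p →ₗ[K]
      grHomology 𝒜 f n p :=
  Homology.map (phi 𝒜 f (n + 2) p) (phi 𝒜 f (n + 1) p) (phi 𝒜 f n p)
    (phi_comm 𝒜 f (n + 1) p) (phi_comm 𝒜 f n p)

/-- The degree-`p` part of `ψ_*`, on `H_{n+1}`. -/
def psiStar (n p : ℕ) :
    reesHomology 𝒜 f n p →ₗ[K]
      grHomology 𝒜 f n p :=
  Homology.map (psi 𝒜 f (n + 2) p) (psi 𝒜 f (n + 1) p) (psi 𝒜 f n p)
    (psi_comm 𝒜 f (n + 1) p) (psi_comm 𝒜 f n p)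

/-- The map `H_{n+1}(Sh(X | LH(F), R))_p → H_{n+1}(Sh(X | LH(F), R))` induced by the inclusion of
the degree-`p` part of the complex. -/
def homologyIncl (n p : ℕ) :
    leadHomology 𝒜 f n p →ₗ[K] shHomology (K := K) (LHs 𝒜 f) n :=
  Homology.map (Submodule.subtype _) (Submodule.subtype _) (Submodule.subtype _)
    (fun _ => rfl) (fun _ => rfl)

/-- The extendable classes of degree `p` in `H_{n+1}(Sh(X | LH(F), R))`: the degree-`p` part of
`φ_*⁻¹(Im ψ_*)`. -/
def extendable (n p : ℕ) : Submodule K (shHomology (K := K) (LHs 𝒜 f) n) :=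
  ((LinearMap.range (psiStar 𝒜 f n p)).comap (phiStar 𝒜 f n p)).map (homologyIncl 𝒜 f n p)

/-- `E_{n+1}(Sh(X | LH(F), R)) = φ_*⁻¹(Im ψ_*)`, the sum of its homogeneous parts. -/
def extendableHomology (n : ℕ) : Submodule K (shHomology (K := K) (LHs 𝒜 f) n) :=
  ⨆ p, extendable 𝒜 f n p

end Extendable

end Shafarevich

end PBW

/-! Conditions 1 and 3 both say that `d_1 : Sh_1(X|F,R) → Sh_0 = R` is strict for the filtrations: a
boundary lying in `F_q` is the boundary of some element of `F_q` (`StrictDifferential 𝒜 f 0`). The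
bridge is `shD_LHs_shProj`: passing from `F` to `LH(F)` changes the differential only in lower
filtration, so `d_{LH(F)}` of the degree-`p` part of `z ∈ F_p` is the degree-`p` part of `d_F z`.

Strictness and 1 (`span_LHs_eq_iff_strict`): the images of `d_1` for `F` and `LH(F)` are `I` and
`⟨LH(F)⟩`. If `r ∈ I` is the boundary of `y ∈ F_{deg r}`, then `LH(r)` is the `LH(F)`-boundary of
the top part of `y`. Conversely, under 1 the top part of a boundary in `F_q` is the `LH(F)`-boundary
of some `x` of degree `q`; subtracting `d_F x` lowers `q`, and one iterates.

Strictness and 3 (`extendableHomology_eq_top_iff_strict`): 3 says that each homogeneous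
`LH(F)`-cycle is the leading part of an `F`-cycle. For such a cycle `x` of degree `p`, `d_F x` lies
in `F_{p-1}`; strictness gives `y ∈ F_{p-1}` with the same boundary, and `x - y` is the `F`-cycle.
Conversely, if `d_F y` lies below the filtration degree of `y`, the top part of `y` is an
`LH(F)`-cycle; subtracting an `F`-cycle with that leading part lowers `y` without changing its
boundary.

For 2, the natural map `R → G(R/I)` is a surjective algebra map with kernel `⟨LH(I)⟩`. For 4, `E_1`
is already a sub-bimodule, hence equal to the bimodule generated by the extendable classes. -/

namespace PBW

/-! ### Homogeneous components in `R` and in the terms `Sh_n`. -/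

section ShProj

variable {K R J : Type*} [Field K] [Ring R] [Algebra K R]
variable (𝒜 : ℕ → Submodule K R) [GradedAlgebra 𝒜] (e : J → ℕ)

/-- The projection of `R` onto its homogeneous component of degree `p`, as a `K`-linear map. -/
def component (p : ℕ) : R →ₗ[K] R :=
  (𝒜 p).subtype ∘ₗ DirectSum.component K ℕ (fun i => 𝒜 i) p ∘ₗ
    (DirectSum.decomposeLinearEquiv 𝒜).toLinearMap

theorem component_apply (p : ℕ) (r : R) : component 𝒜 p r = DirectSum.decompose 𝒜 r p := rfl

theorem component_mem (p : ℕ) (r : R) : component 𝒜 p r ∈ 𝒜 p := SetLike.coe_mem _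

theorem component_of_mem {p q : ℕ} {r : R} (hr : r ∈ 𝒜 q) :
    component 𝒜 p r = if q = p then r else 0 := by
  rw [component_apply]
  split_ifs with h
  · subst h; exact DirectSum.decompose_of_mem_same 𝒜 hr
  · exact DirectSum.decompose_of_mem_ne 𝒜 hr h

theorem component_eq_zero {p q : ℕ} (hqp : q < p) {r : R} (hr : r ∈ gradingFil 𝒜 q) :
    component 𝒜 p r = 0 := by
  have h : gradingFil 𝒜 q ≤ LinearMap.ker (component 𝒜 p) := iSup₂_le fun i hi x hx => by
    rw [LinearMap.mem_ker, component_of_mem 𝒜 hx, if_neg (by omega)]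
  exact h hr

theorem component_eq_zero_of_mem_prev {p : ℕ} {r : R} (hr : r ∈ prev (gradingFil 𝒜) p) :
    component 𝒜 p r = 0 := by
  cases p with
  | zero =>
    have : r = 0 := hr
    rw [this, map_zero]
  | succ p => exact component_eq_zero 𝒜 p.lt_succ_self hr

theorem sub_component_mem_prev {p : ℕ} {r : R} (hr : r ∈ gradingFil 𝒜 p) :
    r - component 𝒜 p r ∈ prev (gradingFil 𝒜) p := by
  have h : gradingFil 𝒜 p ≤
      (prev (gradingFil 𝒜) p).comap (LinearMap.id - component 𝒜 p) :=
    iSup₂_le fun i hi x hx => by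
      rw [Submodule.mem_comap, LinearMap.sub_apply, LinearMap.id_apply, component_of_mem 𝒜 hx]
      split_ifs with hip
      · simp
      · rw [sub_zero]
        exact le_prev (gradingFil_mono 𝒜) (lt_of_le_of_ne hi hip) (mem_gradingFil 𝒜 le_rfl hx)
  exact h hr

theorem component_deg (r : R) : component 𝒜 (deg 𝒜 r) r = LH 𝒜 r := rfl

/-- Either `r` has degree exactly `p`, or it lies lower and has no component there. This puts the
degree-`p` component of any element of `I ∩ F_p R` into `⟨LH(I)⟩` without separate treatment of the
convention `deg 0 = 0`. -/
theorem component_eq_LH_or_eq_zero {p : ℕ} {r : R} (hr : r ∈ gradingFil 𝒜 p) :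
    component 𝒜 p r = LH 𝒜 r ∨ component 𝒜 p r = 0 := by
  classical
  rcases lt_trichotomy (deg 𝒜 r) p with h | h | h
  · exact Or.inr (component_eq_zero 𝒜 h (mem_gradingFil_deg 𝒜 r))
  · exact Or.inl (by rw [← h, component_deg])
  · refine Or.inr (by_contra fun h0 => ?_)
    have hsupp : (DirectSum.decompose 𝒜 r).support.sup id ≤ p := by
      refine Finset.sup_le fun i hi => not_lt.1 fun hpi => ?_
      rw [DFinsupp.mem_support_iff] at hi
      exact hi (Subtype.ext (component_eq_zero 𝒜 hpi hr))
    have hdeg : deg 𝒜 r ≤ p := by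
      refine le_trans (le_of_eq ?_) hsupp
      unfold deg
      congr!
    omega

/-- The projection of `Sh_n` onto its homogeneous part of degree `p`. -/
def shProj (n p : ℕ) : Sh K R J n →ₗ[K] Sh K R J n :=
  Finsupp.lsum K fun w => Finsupp.lsingle w ∘ₗ
    ∑ q ∈ (Finset.range (p + 1)).filter (fun s => s + ∑ i, e (w i) = p) |>.biUnion
      fun s => Finset.piAntidiag (Finset.univ : Finset (Fin (n + 1))) s,
      PiTensorProduct.map fun i => component 𝒜 (q i)

theorem shProj_tensor (n p : ℕ) (w : Fin n → J) (a : Fin (n + 1) → R) :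
    shProj 𝒜 e n p (Sh.tensor K w a) =
      ∑ q ∈ (Finset.range (p + 1)).filter (fun s => s + ∑ i, e (w i) = p) |>.biUnion
        fun s => Finset.piAntidiag (Finset.univ : Finset (Fin (n + 1))) s,
        Sh.tensor K w fun i => component 𝒜 (q i) (a i) := by
  simp [shProj, Sh.tensor]

/-- The index set of `shProj` selects the total `t` by the equation `t + s = p` rather than as `p -
s`, so that it is empty when `s > p` and truncated subtraction never enters. -/
theorem mem_biUnion_piAntidiag {n p s : ℕ} {q : Fin (n + 1) → ℕ} :
    q ∈ ((Finset.range (p + 1)).filter (fun t => t + s = p)).biUnion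
        (fun t => Finset.piAntidiag (Finset.univ : Finset (Fin (n + 1))) t) ↔
      ∑ i, q i + s = p := by
  simp only [Finset.mem_biUnion, Finset.mem_filter, Finset.mem_range, Finset.mem_piAntidiag,
    Finset.mem_univ, implies_true, and_true]
  constructor
  · rintro ⟨t, ⟨-, h⟩, rfl⟩; exact h
  · intro h; exact ⟨_, ⟨by omega, h⟩, rfl⟩

theorem shProj_tensor_of_mem {n p : ℕ} (w : Fin n → J) {a : Fin (n + 1) → R}
    {q : Fin (n + 1) → ℕ} (ha : ∀ i, a i ∈ 𝒜 (q i)) :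
    shProj 𝒜 e n p (Sh.tensor K w a) =
      if ∑ i, q i + ∑ i, e (w i) = p then Sh.tensor K w a else 0 := by
  have hzero : ∀ q', q' ≠ q → Sh.tensor K w (fun i => component 𝒜 (q' i) (a i)) = 0 := by
    intro q' hq'
    obtain ⟨i, hi⟩ := Function.ne_iff.1 hq'
    have : PiTensorProduct.tprod K (fun i => component 𝒜 (q' i) (a i)) = 0 :=
      (PiTensorProduct.tprod K).map_coord_zero i
        (by rw [component_of_mem 𝒜 (ha i), if_neg (Ne.symm hi)])
    simp [Sh.tensor, this]
  rw [shProj_tensor]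
  split_ifs with h
  · rw [Finset.sum_eq_single_of_mem q (mem_biUnion_piAntidiag.2 h) fun q' _ hq' => hzero q' hq']
    congr 1
    funext i
    rw [component_of_mem 𝒜 (ha i), if_pos rfl]
  · exact Finset.sum_eq_zero fun q' hq' => hzero q' fun hqq => h (by
      rw [← hqq]; exact mem_biUnion_piAntidiag.1 hq')

theorem shProj_mem (n p : ℕ) (z : Sh K R J n) : shProj 𝒜 e n p z ∈ shDeg 𝒜 e n p := by
  induction z using Sh.ind with
  | zero => simp
  | smul k z h => rw [map_smul]; exact Submodule.smul_mem _ _ h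
  | add y z hy hz => rw [map_add]; exact add_mem hy hz
  | tensor w a =>
    rw [shProj_tensor]
    exact sum_mem fun q hq => Submodule.subset_span
      ⟨w, _, q, fun i => component_mem 𝒜 _ _, mem_biUnion_piAntidiag.1 hq, rfl⟩

theorem shProj_of_mem {n p q : ℕ} {z : Sh K R J n} (hz : z ∈ shDeg 𝒜 e n q) :
    shProj 𝒜 e n p z = if q = p then z else 0 := by
  have h : shDeg 𝒜 e n q ≤
      LinearMap.ker (shProj 𝒜 e n p - if q = p then LinearMap.id else 0) := by
    refine Submodule.span_le.2 ?_
    rintro _ ⟨w, a, d, ha, hd, rfl⟩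
    rw [SetLike.mem_coe, LinearMap.mem_ker, LinearMap.sub_apply, shProj_tensor_of_mem 𝒜 e w ha, hd]
    split_ifs <;> simp
  have := h hz
  rw [LinearMap.mem_ker, LinearMap.sub_apply, sub_eq_zero] at this
  rw [this]
  split_ifs <;> rfl

/-- Together with `shProj_eq_zero_of_mem_prev`, this identifies `F_p / F_{p-1}` with the degree-`p`
part of `Sh_n`, so arguments about the associated graded complex can be carried out on honest
components. -/
theorem sub_shProj_mem_prev {n p : ℕ} {z : Sh K R J n} (hz : z ∈ shFil 𝒜 e n p) :
    z - shProj 𝒜 e n p z ∈ prev (shFil 𝒜 e n) p := by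
  have h : shFil 𝒜 e n p ≤
      (prev (shFil 𝒜 e n) p).comap (LinearMap.id - shProj 𝒜 e n p) := by
    refine Submodule.span_le.2 ?_
    rintro _ ⟨w, a, d, ha, hd, rfl⟩
    rw [SetLike.mem_coe, Submodule.mem_comap, LinearMap.sub_apply, LinearMap.id_apply,
      shProj_tensor_of_mem 𝒜 e w ha]
    split_ifs with hdp
    · simp
    · rw [sub_zero]
      exact le_prev (shFil_mono 𝒜 e n) (lt_of_le_of_ne hd hdp)
        (Submodule.subset_span ⟨w, a, d, ha, le_rfl, rfl⟩)
  exact h hz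

theorem shProj_eq_zero_of_mem_prev {n p : ℕ} {z : Sh K R J n} (hz : z ∈ prev (shFil 𝒜 e n) p) :
    shProj 𝒜 e n p z = 0 := by
  cases p with
  | zero =>
    have : z = 0 := hz
    rw [this, map_zero]
  | succ p =>
    refine (Submodule.span_le (p := LinearMap.ker (shProj 𝒜 e n (p + 1)))).2 ?_ hz
    rintro _ ⟨w, a, d, ha, hd, rfl⟩
    rw [SetLike.mem_coe, LinearMap.mem_ker, shProj_tensor_of_mem 𝒜 e w ha, if_neg (by omega)]

/-- Each entry of an elementary tensor is the sum of its homogeneous components; expand by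
multilinearity. -/
theorem iSup_shDeg (n : ℕ) : ⨆ p, shDeg 𝒜 e n p = (⊤ : Submodule K (Sh K R J n)) := by
  classical
  refine eq_top_iff.2 fun z _ => ?_
  induction z using Sh.ind with
  | zero => exact zero_mem _
  | smul k z h => exact Submodule.smul_mem _ _ (h trivial)
  | add y z hy hz => exact add_mem (hy trivial) (hz trivial)
  | tensor w a =>
    have ha : a = fun i => ∑ d ∈ (DirectSum.decompose 𝒜 (a i)).support, component 𝒜 d (a i) :=
      funext fun i => (DirectSum.sum_support_decompose 𝒜 (a i)).symm
    have hsum : Sh.tensor K w a =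
        ∑ q ∈ Fintype.piFinset fun i => (DirectSum.decompose 𝒜 (a i)).support,
          Sh.tensor K w fun i => component 𝒜 (q i) (a i) := by
      conv_lhs => rw [ha]
      simp only [Sh.tensor]
      rw [MultilinearMap.map_sum_finset, ← Finsupp.lsingle_apply (R := K), map_sum]
      rfl
    rw [hsum]
    exact sum_mem fun q _ => Submodule.mem_iSup_of_mem _ (Submodule.subset_span
      ⟨w, _, q, fun i => component_mem 𝒜 _ _, rfl, rfl⟩)

theorem exists_mem_shFil (n : ℕ) (z : Sh K R J n) : ∃ p, z ∈ shFil 𝒜 e n p := by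
  have hz : z ∈ ⨆ p, shFil 𝒜 e n p :=
    iSup_mono (fun p => shDeg_le_shFil 𝒜 e n p) (iSup_shDeg (K := K) 𝒜 e n ▸ Submodule.mem_top)
  exact (Submodule.mem_iSup_of_directed _ (shFil_mono 𝒜 e n).directed_le).1 hz

theorem shProj_shD {c : J → R} (hc : ∀ j, c j ∈ 𝒜 (e j)) (n p : ℕ) (z : Sh K R J (n + 1)) :
    shProj 𝒜 e n p (shD K c n z) = shD K c n (shProj 𝒜 e (n + 1) p z) := by
  have hz : z ∈ ⨆ p, shDeg 𝒜 e (n + 1) p := iSup_shDeg (K := K) 𝒜 e (n + 1) ▸ Submodule.mem_top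
  induction hz using Submodule.iSup_induction' with
  | zero => simp
  | add x y _ _ hx hy => simp only [map_add, hx, hy]
  | mem q x hx =>
    rw [shProj_of_mem 𝒜 e hx, shProj_of_mem 𝒜 e (shD_mem_shDeg 𝒜 e hc n q x hx)]
    split_ifs <;> simp

theorem sum_shProj {n p : ℕ} {z : Sh K R J n} (hz : z ∈ shFil 𝒜 e n p) :
    ∑ q ∈ Finset.range (p + 1), shProj 𝒜 e n q z = z := by
  have h : shFil 𝒜 e n p ≤
      LinearMap.eqLocus (∑ q ∈ Finset.range (p + 1), shProj 𝒜 e n q) LinearMap.id := by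
    refine Submodule.span_le.2 ?_
    rintro _ ⟨w, a, d, ha, hd, rfl⟩
    simp only [SetLike.mem_coe, LinearMap.mem_eqLocus, LinearMap.sum_apply, LinearMap.id_apply,
      shProj_tensor_of_mem 𝒜 e w ha]
    rw [Finset.sum_ite_eq, if_pos (Finset.mem_range.2 (by omega))]
  simpa using h hz

end ShProj

/-! ### Extendable classes and strictness of the differential. -/

section Extension

variable {K R J : Type*} [Field K] [Ring R] [Algebra K R]

theorem Gr.proj_eq_sub_iff {M : Type*} [AddCommGroup M] [Module K M] {F : ℕ → Submodule K M}
    {p : ℕ} (x y z : F p) :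
    Gr.proj F p x = Gr.proj F p y - Gr.proj F p z ↔ (x : M) - (y - z) ∈ prev F p := by
  rw [← map_sub, Gr.proj_eq_iff, AddSubgroupClass.coe_sub]

section Homology

variable {A B C A' B' C' A'' B'' C'' : Type*} [AddCommGroup A]
  [Module K A] [AddCommGroup B] [Module K B] [AddCommGroup C] [Module K C] [AddCommGroup A']
  [Module K A'] [AddCommGroup B'] [Module K B'] [AddCommGroup C'] [Module K C']
  [AddCommGroup A''] [Module K A''] [AddCommGroup B''] [Module K B''] [AddCommGroup C'']
  [Module K C'']

/-- The homology class of a cycle. -/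
def Homology.mk (f : A →ₗ[K] B) (g : B →ₗ[K] C) (z : B) (hz : g z = 0) : Homology f g :=
  Submodule.Quotient.mk ⟨z, hz⟩

theorem Homology.exists_mk {f : A →ₗ[K] B} {g : B →ₗ[K] C} (h : Homology f g) :
    ∃ z hz, Homology.mk f g z hz = h := by
  obtain ⟨⟨z, hz⟩, rfl⟩ := Submodule.Quotient.mk_surjective _ h
  exact ⟨z, hz, rfl⟩

variable {f : A →ₗ[K] B} {g : B →ₗ[K] C} {f' : A' →ₗ[K] B'} {g' : B' →ₗ[K] C'}
  {f'' : A'' →ₗ[K] B''} {g'' : B'' →ₗ[K] C''} {α : A →ₗ[K] A''} {β : B →ₗ[K] B''}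
  {γ : C →ₗ[K] C''} {α' : A' →ₗ[K] A''} {β' : B' →ₗ[K] B''} {γ' : C' →ₗ[K] C''}
  {h₁ : ∀ x, β (f x) = f'' (α x)} {h₂ : ∀ y, γ (g y) = g'' (β y)}
  {h₁' : ∀ x, β' (f' x) = f'' (α' x)} {h₂' : ∀ y, γ' (g' y) = g'' (β' y)}

/-- The two morphisms share only their target, as `φ_*` and `ψ_*` do; membership in `φ_*⁻¹(Im ψ_*)`
is an equation of this shape. -/
theorem Homology.map_mk_eq_map_mk {z : B} {hz : g z = 0} {z' : B'} {hz' : g' z' = 0} :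
    Homology.map α β γ h₁ h₂ (Homology.mk f g z hz) =
        Homology.map α' β' γ' h₁' h₂' (Homology.mk f' g' z' hz') ↔ ∃ x, f'' x = β z - β' z' :=
  Submodule.Quotient.eq _

end Homology

/-- Elements of `F_p Sh_{n+1}` that differ from a cycle of `Sh(X | F, R)` in `F_p` by an element of
`F_{p-1}`. -/
def liftable (𝒜 : ℕ → Submodule K R) [GradedAlgebra 𝒜] (f : J → R) (n p : ℕ) :
    Submodule K (Sh K R J (n + 1)) :=
  (LinearMap.ker (shD K f n) ⊓ shFil 𝒜 (degs 𝒜 f) (n + 1) p) ⊔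
    prev (shFil 𝒜 (degs 𝒜 f) (n + 1)) p

/-- The differential `Sh_{n+1} → Sh_n` of `Sh(X | F, R)` is strict for the filtrations. -/
def StrictDifferential (𝒜 : ℕ → Submodule K R) [GradedAlgebra 𝒜] (f : J → R) (n : ℕ) : Prop :=
  ∀ q, ∀ y : Sh K R J (n + 1), shD K f n y ∈ shFil 𝒜 (degs 𝒜 f) n q →
    ∃ y' ∈ shFil 𝒜 (degs 𝒜 f) (n + 1) q, shD K f n y' = shD K f n y

variable (𝒜 : ℕ → Submodule K R) [GradedAlgebra 𝒜] (f : J → R)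

theorem mem_liftable {n p : ℕ} {z : Sh K R J (n + 1)} :
    z ∈ liftable 𝒜 f n p ↔ ∃ y ∈ shFil 𝒜 (degs 𝒜 f) (n + 1) p, shD K f n y = 0 ∧
      y - z ∈ prev (shFil 𝒜 (degs 𝒜 f) (n + 1)) p := by
  rw [liftable, Submodule.mem_sup]
  constructor
  · rintro ⟨y, ⟨hy, hyp⟩, v, hv, rfl⟩
    exact ⟨y, hyp, hy, by rw [sub_add_cancel_left]; exact neg_mem hv⟩
  · rintro ⟨y, hyp, hy, hv⟩
    exact ⟨y, ⟨hy, hyp⟩, z - y, by rw [← neg_sub]; exact neg_mem hv, add_sub_cancel _ _⟩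

theorem shProj_shD_LHs (n p : ℕ) (z : Sh K R J (n + 1)) :
    shProj 𝒜 (degs 𝒜 f) n p (shD K (LHs 𝒜 f) n z) =
      shD K (LHs 𝒜 f) n (shProj 𝒜 (degs 𝒜 f) (n + 1) p z) :=
  shProj_shD 𝒜 _ (fun j => LH_mem 𝒜 (f j)) n p z

theorem shD_sub_shD_LHs_mem {n p : ℕ} {z : Sh K R J (n + 1)}
    (hz : z ∈ shFil 𝒜 (degs 𝒜 f) (n + 1) p) :
    shD K f n z - shD K (LHs 𝒜 f) n z ∈ prev (shFil 𝒜 (degs 𝒜 f) n) p :=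
  shD_sub_mem 𝒜 _ (fun j => sub_LH_mem 𝒜 (f j)) n p z hz

/-- The two differentials agree on `F_p` modulo `F_{p-1}`, which `shProj` in degree `p` does not
see, and the `LH(F)`-differential commutes with that projection. -/
theorem shD_LHs_shProj {n p : ℕ} {z : Sh K R J (n + 1)}
    (hz : z ∈ shFil 𝒜 (degs 𝒜 f) (n + 1) p) :
    shD K (LHs 𝒜 f) n (shProj 𝒜 (degs 𝒜 f) (n + 1) p z) =
      shProj 𝒜 (degs 𝒜 f) n p (shD K f n z) := by
  rw [← shProj_shD_LHs, eq_comm, ← sub_eq_zero, ← map_sub]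
  exact shProj_eq_zero_of_mem_prev 𝒜 _ (shD_sub_shD_LHs_mem 𝒜 f hz)

/-- A class of degree `p` is extendable exactly when it has a representative of degree `p` that is
the leading part of a cycle of `Sh(X | F, R)`. -/
theorem mem_extendable {n p : ℕ} {h : shHomology (K := K) (LHs 𝒜 f) n} :
    h ∈ extendable 𝒜 f n p ↔ ∃ z : LinearMap.ker (shD K (LHs 𝒜 f) n),
      z.1 ∈ shDeg 𝒜 (degs 𝒜 f) (n + 1) p ∧ z.1 ∈ liftable 𝒜 f n p ∧
        Submodule.Quotient.mk z = h := by
  constructor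
  · rintro ⟨x, ⟨t, ht⟩, rfl⟩
    obtain ⟨⟨z, hzp⟩, hz, rfl⟩ := Homology.exists_mk x
    obtain ⟨⟨y, hyp⟩, hy, rfl⟩ := Homology.exists_mk t
    refine ⟨⟨z, congrArg Subtype.val hz⟩, hzp, ?_, rfl⟩
    obtain ⟨u, hu⟩ := Homology.map_mk_eq_map_mk.1 ht
    obtain ⟨⟨u, hup⟩, rfl⟩ := Submodule.Quotient.mk_surjective _ u
    have hmem : shD K f (n + 1) u - (y - z) ∈ prev (shFil 𝒜 (degs 𝒜 f) (n + 1)) p :=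
      (Gr.proj_eq_sub_iff (F := shFil 𝒜 (degs 𝒜 f) (n + 1)) (reesD 𝒜 f (n + 1) p ⟨u, hup⟩)
        ⟨y, hyp⟩ ⟨z, shDeg_le_shFil 𝒜 _ _ _ hzp⟩).1 hu
    -- The classes of `y` and `z` agree only up to a boundary `d u` in the associated graded
    -- complex. Subtracting it keeps `y` an `F`-cycle and makes it congruent to `z` modulo
    -- `F_{p-1}`.
    refine (mem_liftable 𝒜 f).2 ⟨y - shD K f (n + 1) u,
      sub_mem hyp (shD_filtered 𝒜 f (n + 1) p _ hup), ?_, ?_⟩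
    · rw [map_sub, shD_shD, sub_zero]
      exact congrArg Subtype.val hy
    · rw [sub_right_comm, ← neg_sub]
      exact neg_mem hmem
  · rintro ⟨⟨z, hz⟩, hzp, hl, rfl⟩
    obtain ⟨y, hyp, hy, hv⟩ := (mem_liftable 𝒜 f).1 hl
    refine ⟨Homology.mk _ _ ⟨z, hzp⟩ (Subtype.ext hz),
      ⟨Homology.mk _ _ ⟨y, hyp⟩ (Subtype.ext hy), ?_⟩, rfl⟩
    -- No boundary is needed: `y` and `z` already coincide in `F_p / F_{p-1}`.
    refine Homology.map_mk_eq_map_mk.2 ⟨0, ?_⟩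
    rw [map_zero, eq_comm, sub_eq_zero]
    exact (Gr.proj_eq_iff (F := shFil 𝒜 (degs 𝒜 f) (n + 1)) ⟨y, hyp⟩
      ⟨z, shDeg_le_shFil 𝒜 _ _ _ hzp⟩).2 hv

/-- The `F`-boundary of `u` is a cycle by `d² = 0` and has the `LH(F)`-boundary of `u` as leading
part. Hence liftability does not depend on the representative of a class. -/
theorem shD_mem_liftable {n p : ℕ} {u : Sh K R J (n + 2)}
    (hu : u ∈ shDeg 𝒜 (degs 𝒜 f) (n + 2) p) :
    shD K (LHs 𝒜 f) (n + 1) u ∈ liftable 𝒜 f n p :=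
  (mem_liftable 𝒜 f).2 ⟨shD K f (n + 1) u,
    shD_filtered 𝒜 f (n + 1) p _ (shDeg_le_shFil 𝒜 _ _ _ hu), shD_shD f n u,
    shD_sub_shD_LHs_mem 𝒜 f (shDeg_le_shFil 𝒜 _ _ _ hu)⟩

/-- Extendability can be tested degree by degree on any chosen representative, because boundaries
are liftable in every degree. -/
theorem mk_mem_extendableHomology_iff {n : ℕ} (z : LinearMap.ker (shD K (LHs 𝒜 f) n)) :
    (Submodule.Quotient.mk z : shHomology (K := K) (LHs 𝒜 f) n) ∈ extendableHomology 𝒜 f n ↔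
      ∀ p, shProj 𝒜 (degs 𝒜 f) (n + 1) p z.1 ∈ liftable 𝒜 f n p := by
  constructor
  · intro hz p
    -- Quantifying over all representatives lets the induction over the supremum choose
    -- representatives of the summands freely; the discrepancy is handled by `boundary`.
    have key : ∀ h ∈ extendableHomology 𝒜 f n, ∀ z : LinearMap.ker (shD K (LHs 𝒜 f) n),
        Submodule.Quotient.mk z = h →
          shProj 𝒜 (degs 𝒜 f) (n + 1) p z.1 ∈ liftable 𝒜 f n p := by
      have boundary : ∀ z : LinearMap.ker (shD K (LHs 𝒜 f) n),
          (Submodule.Quotient.mk z : shHomology (K := K) (LHs 𝒜 f) n) = 0 →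
            shProj 𝒜 (degs 𝒜 f) (n + 1) p z.1 ∈ liftable 𝒜 f n p := by
        intro z hz
        obtain ⟨u, hu⟩ := (Submodule.Quotient.mk_eq_zero _).1 hz
        have hu' : shD K (LHs 𝒜 f) (n + 1) u = z.1 := hu
        rw [← hu', shProj_shD_LHs]
        exact shD_mem_liftable 𝒜 f (shProj_mem 𝒜 _ _ _ _)
      intro h hh
      induction hh using Submodule.iSup_induction' with
      | zero => exact boundary
      | add x y _ _ hx hy =>
        intro z hz
        induction x using Submodule.Quotient.induction_on with | _ x
        induction y using Submodule.Quotient.induction_on with | _ y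
        have h₁ := add_mem (add_mem (hx x rfl) (hy y rfl)) (boundary (z - (x + y)) (by
          rw [Submodule.Quotient.mk_sub, hz, Submodule.Quotient.mk_add, sub_self]))
        rw [← map_add, ← map_add] at h₁
        convert h₁ using 2
        simp
      | mem q x hx =>
        intro z hz
        obtain ⟨x', hq, hl, rfl⟩ := (mem_extendable 𝒜 f).1 hx
        have hx' : shProj 𝒜 (degs 𝒜 f) (n + 1) p x'.1 ∈ liftable 𝒜 f n p := by
          rw [shProj_of_mem 𝒜 _ hq]
          split_ifs with hqp
          · exact hqp ▸ hl
          · exact zero_mem _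
        have h₁ := add_mem hx' (boundary (z - x') (by
          rw [Submodule.Quotient.mk_sub, hz, sub_self]))
        rw [← map_add] at h₁
        convert h₁ using 2
        simp
    exact key _ hz z rfl
  · intro hz
    obtain ⟨N, hN⟩ := exists_mem_shFil 𝒜 (degs 𝒜 f) (n + 1) z.1
    have hcyc : ∀ p, shD K (LHs 𝒜 f) n (shProj 𝒜 (degs 𝒜 f) (n + 1) p z.1) = 0 := fun p => by
      rw [← shProj_shD_LHs, z.2, map_zero]
    have hsum : z = ∑ p ∈ Finset.range (N + 1),
        (⟨shProj 𝒜 (degs 𝒜 f) (n + 1) p z.1, hcyc p⟩ : LinearMap.ker (shD K (LHs 𝒜 f) n)) := by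
      refine Subtype.ext ?_
      rw [AddSubmonoidClass.coe_finsetSum]
      exact (sum_shProj 𝒜 _ hN).symm
    rw [hsum, ← Submodule.mkQ_apply, map_sum]
    exact sum_mem fun p _ => Submodule.mem_iSup_of_mem p
      ((mem_extendable 𝒜 f).2 ⟨_, shProj_mem 𝒜 _ _ _ _, hz p, rfl⟩)

theorem extendableHomology_eq_top_iff_liftable (n : ℕ) :
    extendableHomology 𝒜 f n = ⊤ ↔ ∀ p, ∀ x ∈ shDeg 𝒜 (degs 𝒜 f) (n + 1) p,
      shD K (LHs 𝒜 f) n x = 0 → x ∈ liftable 𝒜 f n p := by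
  constructor
  · intro h p x hxp hx
    have := (mk_mem_extendableHomology_iff 𝒜 f ⟨x, hx⟩).1 (h ▸ Submodule.mem_top) p
    rwa [shProj_of_mem 𝒜 _ hxp, if_pos rfl] at this
  · refine fun h => eq_top_iff.2 fun z _ => ?_
    induction z using Submodule.Quotient.induction_on with | _ z
    refine (mk_mem_extendableHomology_iff 𝒜 f z).2 fun p => h p _ (shProj_mem 𝒜 _ _ _ _) ?_
    rw [← shProj_shD_LHs, z.2, map_zero]

/-- All classes are extendable exactly when the differential of `Sh(X | F, R)` is strict. -/
theorem extendableHomology_eq_top_iff_strict (n : ℕ) :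
    extendableHomology 𝒜 f n = ⊤ ↔ StrictDifferential 𝒜 f n := by
  rw [extendableHomology_eq_top_iff_liftable]
  constructor
  · intro h q y hy
    obtain ⟨p, hp⟩ := exists_mem_shFil 𝒜 (degs 𝒜 f) (n + 1) y
    induction p generalizing y with
    | zero => exact ⟨y, shFil_mono 𝒜 _ _ (Nat.zero_le q) hp, rfl⟩
    | succ p ih =>
      rcases le_or_gt (p + 1) q with hpq | hpq
      · exact ⟨y, shFil_mono 𝒜 _ _ hpq hp, rfl⟩
      -- As `q < p + 1`, the boundary of `y` has no component of degree `p + 1`, so the top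
      -- component of `y` is an `LH(F)`-cycle. An `F`-cycle `k` with this leading part makes `y - k`
      -- lie in `F_p` with the boundary unchanged.
      obtain ⟨k, hkp, hk, hv⟩ := (mem_liftable 𝒜 f).1 (h (p + 1)
        (shProj 𝒜 (degs 𝒜 f) (n + 1) (p + 1) y) (shProj_mem 𝒜 _ _ _ _) (by
          rw [shD_LHs_shProj 𝒜 f hp]
          exact shProj_eq_zero_of_mem_prev 𝒜 _ (le_prev (shFil_mono 𝒜 _ _) hpq hy)))
      have hyk : shD K f n (y - k) = shD K f n y := by rw [map_sub, hk, sub_zero]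
      have hmem : y - k ∈ shFil 𝒜 (degs 𝒜 f) (n + 1) p := by
        have := sub_mem (sub_shProj_mem_prev 𝒜 _ hp) hv
        rwa [sub_sub_sub_cancel_right] at this
      obtain ⟨y', hy', hyy⟩ := ih (y - k) (hyk ▸ hy) hmem
      exact ⟨y', hy', hyy.trans hyk⟩
  · intro h p x hxp hx
    have hxF := shDeg_le_shFil 𝒜 _ _ _ hxp
    have hd := shD_sub_shD_LHs_mem 𝒜 f hxF
    rw [hx, sub_zero] at hd
    refine (mem_liftable 𝒜 f).2 ?_
    cases p with
    -- Since `F_{-1} = 0`, `hd` says that `x` is itself an `F`-cycle.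
    | zero => exact ⟨x, hxF, hd, by rw [sub_self]; exact zero_mem _⟩
    | succ p =>
      obtain ⟨y, hy, hyx⟩ := h p x hd
      refine ⟨x - y, sub_mem hxF (shFil_mono 𝒜 _ _ p.le_succ hy), by
        rw [map_sub, hyx, sub_self], ?_⟩
      rw [sub_sub_cancel_left]
      exact neg_mem hy

end Extension

/-! ### The extendable classes form a sub-bimodule. -/

section Bimodule

variable {K R J : Type*} [Field K] [Ring R] [Algebra K R]
variable (𝒜 : ℕ → Submodule K R) [GradedAlgebra 𝒜] (f : J → R)

theorem update_mul_mem {n m : ℕ} {r : R} (hr : r ∈ 𝒜 m) {a : Fin (n + 1) → R}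
    {q : Fin (n + 1) → ℕ} (ha : ∀ i, a i ∈ 𝒜 (q i)) (k : Fin (n + 1)) :
    (∀ i, Function.update a k (r * a k) i ∈ 𝒜 (Function.update q k (m + q k) i)) ∧
    (∀ i, Function.update a k (a k * r) i ∈ 𝒜 (Function.update q k (m + q k) i)) ∧
      ∑ i, Function.update q k (m + q k) i = m + ∑ i, q i := by
  refine ⟨fun i => ?_, fun i => ?_, ?_⟩
  · rcases eq_or_ne i k with rfl | hi
    · simpa using SetLike.mul_mem_graded hr (ha i)
    · simpa [hi] using ha i
  · rcases eq_or_ne i k with rfl | hi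
    · simpa [add_comm m] using SetLike.mul_mem_graded (ha i) hr
    · simpa [hi] using ha i
  · rw [Finset.sum_update_of_mem (Finset.mem_univ k), add_assoc]
    congr 1
    rw [← Finset.sum_erase_add _ _ (Finset.mem_univ k), Finset.sdiff_singleton_eq_erase, add_comm]

theorem shLeft_mem {e : J → ℕ} {n m p : ℕ} {r : R} (hr : r ∈ 𝒜 m) :
    (∀ z ∈ shDeg 𝒜 e n p, shLeft K J r n z ∈ shDeg 𝒜 e n (m + p)) ∧
      ∀ z ∈ shFil 𝒜 e n p, shLeft K J r n z ∈ shFil 𝒜 e n (m + p) := by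
  refine ⟨fun z hz => (Submodule.span_le (p := (shDeg 𝒜 e n (m + p)).comap (shLeft K J r n))).2 ?_ hz,
    fun z hz => (Submodule.span_le (p := (shFil 𝒜 e n (m + p)).comap (shLeft K J r n))).2 ?_ hz⟩
  all_goals
    rintro _ ⟨w, a, q, ha, hq, rfl⟩
    rw [SetLike.mem_coe, Submodule.mem_comap, shLeft_tensor]
    obtain ⟨h, -, hs⟩ := update_mul_mem 𝒜 hr ha 0
    exact Submodule.subset_span ⟨w, _, _, h, by omega, rfl⟩

theorem shRight_mem {e : J → ℕ} {n m p : ℕ} {r : R} (hr : r ∈ 𝒜 m) :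
    (∀ z ∈ shDeg 𝒜 e n p, shRight K J r n z ∈ shDeg 𝒜 e n (m + p)) ∧
      ∀ z ∈ shFil 𝒜 e n p, shRight K J r n z ∈ shFil 𝒜 e n (m + p) := by
  refine ⟨fun z hz => (Submodule.span_le (p := (shDeg 𝒜 e n (m + p)).comap (shRight K J r n))).2 ?_ hz,
    fun z hz => (Submodule.span_le (p := (shFil 𝒜 e n (m + p)).comap (shRight K J r n))).2 ?_ hz⟩
  all_goals
    rintro _ ⟨w, a, q, ha, hq, rfl⟩
    rw [SetLike.mem_coe, Submodule.mem_comap, shRight_tensor]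
    obtain ⟨-, h, hs⟩ := update_mul_mem 𝒜 hr ha (Fin.last n)
    exact Submodule.subset_span ⟨w, _, _, h, by omega, rfl⟩

theorem map_prev_le {M : Type*} [AddCommGroup M] [Module K M] {F : ℕ → Submodule K M}
    (hF : Monotone F) {m : ℕ} {g : M →ₗ[K] M} (hg : ∀ p, ∀ z ∈ F p, g z ∈ F (m + p)) {p : ℕ} {z : M}
    (hz : z ∈ prev F p) : g z ∈ prev F (m + p) := by
  cases p with
  | zero =>
    have : z = 0 := hz
    rw [this, map_zero]
    exact zero_mem _
  | succ p => exact le_prev hF (by omega) (hg p z hz)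

/-- Multiply both the cycle and its lift by `r`: the differentials are bimodule maps, and
multiplication by a homogeneous element of degree `m` shifts grading and filtration by `m`. -/
theorem homologyLeft_mem_extendable {n m p : ℕ} {r : R} (hr : r ∈ 𝒜 m)
    {h : shHomology (K := K) (LHs 𝒜 f) n} (hh : h ∈ extendable 𝒜 f n p) :
    homologyLeft (LHs 𝒜 f) n r h ∈ extendable 𝒜 f n (m + p) := by
  obtain ⟨⟨z, hz⟩, hzp, hl, rfl⟩ := (mem_extendable 𝒜 f).1 hh
  obtain ⟨y, hyp, hy, hv⟩ := (mem_liftable 𝒜 f).1 hl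
  refine (mem_extendable 𝒜 f).2 ⟨⟨shLeft K J r (n + 1) z, ?_⟩, (shLeft_mem 𝒜 hr).1 z hzp,
    (mem_liftable 𝒜 f).2 ⟨shLeft K J r (n + 1) y, (shLeft_mem 𝒜 hr).2 y hyp, ?_, ?_⟩, rfl⟩
  · rw [LinearMap.mem_ker, ← shD_shLeft, hz, map_zero]
  · rw [← shD_shLeft, hy, map_zero]
  · rw [← map_sub]
    exact map_prev_le (shFil_mono 𝒜 _ _) (fun p => (shLeft_mem 𝒜 hr).2) hv

theorem homologyRight_mem_extendable {n m p : ℕ} {r : R} (hr : r ∈ 𝒜 m)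
    {h : shHomology (K := K) (LHs 𝒜 f) n} (hh : h ∈ extendable 𝒜 f n p) :
    homologyRight (LHs 𝒜 f) n r h ∈ extendable 𝒜 f n (m + p) := by
  obtain ⟨⟨z, hz⟩, hzp, hl, rfl⟩ := (mem_extendable 𝒜 f).1 hh
  obtain ⟨y, hyp, hy, hv⟩ := (mem_liftable 𝒜 f).1 hl
  refine (mem_extendable 𝒜 f).2 ⟨⟨shRight K J r (n + 1) z, ?_⟩, (shRight_mem 𝒜 hr).1 z hzp,
    (mem_liftable 𝒜 f).2 ⟨shRight K J r (n + 1) y, (shRight_mem 𝒜 hr).2 y hyp, ?_, ?_⟩, rfl⟩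
  · rw [LinearMap.mem_ker, ← shD_shRight, hz, map_zero]
  · rw [← shD_shRight, hy, map_zero]
  · rw [← map_sub]
    exact map_prev_le (shFil_mono 𝒜 _ _) (fun p => (shRight_mem 𝒜 hr).2) hv

theorem shLeft_add (r s : R) (n : ℕ) (z : Sh K R J n) :
    shLeft K J (r + s) n z = shLeft K J r n z + shLeft K J s n z := by
  induction z using Sh.ind with
  | zero => simp
  | smul k z h => simp only [map_smul, h, smul_add]
  | add y z hy hz => simp only [map_add, hy, hz]; abel
  | tensor w a =>
    rw [shLeft_tensor, shLeft_tensor, shLeft_tensor]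
    simp only [Sh.tensor, add_mul, MultilinearMap.map_update_add, Finsupp.single_add]

theorem shRight_add (r s : R) (n : ℕ) (z : Sh K R J n) :
    shRight K J (r + s) n z = shRight K J r n z + shRight K J s n z := by
  induction z using Sh.ind with
  | zero => simp
  | smul k z h => simp only [map_smul, h, smul_add]
  | add y z hy hz => simp only [map_add, hy, hz]; abel
  | tensor w a =>
    rw [shRight_tensor, shRight_tensor, shRight_tensor]
    simp only [Sh.tensor, mul_add, MultilinearMap.map_update_add, Finsupp.single_add]

/-- Additivity in the ring element reduces stability under `R` to homogeneous multipliers. -/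
theorem homologyLeft_add (c : J → R) (n : ℕ) (r s : R) (h : shHomology (K := K) c n) :
    homologyLeft c n (r + s) h = homologyLeft c n r h + homologyLeft c n s h := by
  induction h using Submodule.Quotient.induction_on with | _ z
  exact congrArg Submodule.Quotient.mk (Subtype.ext (shLeft_add r s (n + 1) z.1))

theorem homologyRight_add (c : J → R) (n : ℕ) (r s : R) (h : shHomology (K := K) c n) :
    homologyRight c n (r + s) h = homologyRight c n r h + homologyRight c n s h := by
  induction h using Submodule.Quotient.induction_on with | _ z
  exact congrArg Submodule.Quotient.mk (Subtype.ext (shRight_add r s (n + 1) z.1))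

theorem homologyLeft_zero (c : J → R) (n : ℕ) (h : shHomology (K := K) c n) :
    homologyLeft c n 0 h = 0 := by
  simpa using homologyLeft_add c n 0 0 h

theorem homologyRight_zero (c : J → R) (n : ℕ) (h : shHomology (K := K) c n) :
    homologyRight c n 0 h = 0 := by
  simpa using homologyRight_add c n 0 0 h

theorem homologyLeft_mem_extendableHomology {n : ℕ} (r : R)
    {h : shHomology (K := K) (LHs 𝒜 f) n} (hh : h ∈ extendableHomology 𝒜 f n) :
    homologyLeft (LHs 𝒜 f) n r h ∈ extendableHomology 𝒜 f n := by
  induction r using DirectSum.Decomposition.inductionOn 𝒜 with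
  | zero => rw [homologyLeft_zero]; exact zero_mem _
  | add r s hr hs => rw [homologyLeft_add]; exact add_mem hr hs
  | @homogeneous m r =>
    induction hh using Submodule.iSup_induction' with
    | zero => rw [map_zero]; exact zero_mem _
    | add x y _ _ hx hy => rw [map_add]; exact add_mem hx hy
    | mem p x hx =>
      exact Submodule.mem_iSup_of_mem _ (homologyLeft_mem_extendable 𝒜 f r.2 hx)

theorem homologyRight_mem_extendableHomology {n : ℕ} (r : R)
    {h : shHomology (K := K) (LHs 𝒜 f) n} (hh : h ∈ extendableHomology 𝒜 f n) :
    homologyRight (LHs 𝒜 f) n r h ∈ extendableHomology 𝒜 f n := by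
  induction r using DirectSum.Decomposition.inductionOn 𝒜 with
  | zero => rw [homologyRight_zero]; exact zero_mem _
  | add r s hr hs => rw [homologyRight_add]; exact add_mem hr hs
  | @homogeneous m r =>
    induction hh using Submodule.iSup_induction' with
    | zero => rw [map_zero]; exact zero_mem _
    | add x y _ _ hx hy => rw [map_add]; exact add_mem hx hy
    | mem p x hx =>
      exact Submodule.mem_iSup_of_mem _ (homologyRight_mem_extendable 𝒜 f r.2 hx)

/-- The extendable classes span a sub-bimodule of the homology. -/
theorem bimoduleSpan_extendable (n : ℕ) :
    bimoduleSpan (LHs 𝒜 f) n {h | ∃ p, h ∈ extendable 𝒜 f n p} = extendableHomology 𝒜 f n := by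
  refine le_antisymm (sInf_le ⟨?_, fun r h hh => ⟨homologyLeft_mem_extendableHomology 𝒜 f r hh,
    homologyRight_mem_extendableHomology 𝒜 f r hh⟩⟩) (le_sInf fun N hN => iSup_le fun p h hh => ?_)
  · rintro h ⟨p, hp⟩
    exact Submodule.mem_iSup_of_mem p hp
  · exact hN.1 ⟨p, hh⟩

end Bimodule

/-! ### The term `Sh_0 = R` and the ideal as the image of `d_1`. -/

section DegreeZero

variable {K R J : Type*} [Field K] [Ring R] [Algebra K R]

variable (K R J) in
/-- The identification `Sh_0 ≃ R`. -/
def shZeroEquiv : Sh K R J 0 ≃ₗ[K] R :=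
  Finsupp.uniqueLinearEquiv K _ (default : Fin 0 → J) ≪≫ₗ
    PiTensorProduct.subsingletonEquiv (ι := Fin 1) 0

@[simp]
theorem shZeroEquiv_tensor (w : Fin 0 → J) (a : Fin 1 → R) :
    shZeroEquiv K R J (Sh.tensor K w a) = a 0 := by
  obtain rfl : w = default := Subsingleton.elim _ _
  simp [shZeroEquiv, Sh.tensor]

theorem shZeroEquiv_shLeft (r : R) (z : Sh K R J 0) :
    shZeroEquiv K R J (shLeft K J r 0 z) = r * shZeroEquiv K R J z := by
  induction z using Sh.ind with
  | zero => simp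
  | smul k z h => simp [h]
  | add y z hy hz => simp [hy, hz, mul_add]
  | tensor w a => rw [shLeft_tensor]; simp

theorem shZeroEquiv_shRight (r : R) (z : Sh K R J 0) :
    shZeroEquiv K R J (shRight K J r 0 z) = shZeroEquiv K R J z * r := by
  induction z using Sh.ind with
  | zero => simp
  | smul k z h => simp [h]
  | add y z hy hz => simp [hy, hz, add_mul]
  | tensor w a => rw [shRight_tensor]; simp

theorem shZeroEquiv_shD_tensor (c : J → R) (w : Fin 1 → J) (a : Fin 2 → R) :
    shZeroEquiv K R J (shD K c 0 (Sh.tensor K w a)) = a 0 * c (w 0) * a 1 := by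
  rw [shD_tensor]
  simp [contract_self]

/-- The two-sided ideal generated by `c` is the image of `d_1` in `Sh(X | c, R)`. -/
theorem mem_span_range_iff (c : J → R) (r : R) :
    r ∈ TwoSidedIdeal.span (Set.range c) ↔ ∃ z, shZeroEquiv K R J (shD K c 0 z) = r := by
  constructor
  · intro hr
    -- The image of `d_1` is a two-sided ideal because `d_1` is a bimodule map, and it contains `c_j
    -- = d_1(1 ⊗ x_j ⊗ 1)`.
    let T : TwoSidedIdeal R := .mk' {r | ∃ z, shZeroEquiv K R J (shD K c 0 z) = r}
      ⟨0, by simp⟩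
      (by rintro _ _ ⟨y, rfl⟩ ⟨z, rfl⟩; exact ⟨y + z, by simp⟩)
      (by rintro _ ⟨y, rfl⟩; exact ⟨-y, by simp⟩)
      (by rintro r _ ⟨y, rfl⟩
          exact ⟨shLeft K J r 1 y, by rw [← shD_shLeft, shZeroEquiv_shLeft]⟩)
      (by rintro _ r ⟨y, rfl⟩
          exact ⟨shRight K J r 1 y, by rw [← shD_shRight, shZeroEquiv_shRight]⟩)
    have hmem : ∀ r, r ∈ T ↔ ∃ z, shZeroEquiv K R J (shD K c 0 z) = r :=
      fun r => TwoSidedIdeal.mem_mk' _ _ _ _ _ _ r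
    have hT : TwoSidedIdeal.span (Set.range c) ≤ T := by
      rw [TwoSidedIdeal.span_le]
      rintro _ ⟨j, rfl⟩
      exact (hmem _).2
        ⟨Sh.tensor K (fun _ => j) (fun _ => 1), by simp [shZeroEquiv_shD_tensor]⟩
    exact (hmem r).1 (hT hr)
  · rintro ⟨z, rfl⟩
    induction z using Sh.ind with
    | zero => simp
    | smul k z h =>
      rw [map_smul, map_smul, Algebra.smul_def]
      exact TwoSidedIdeal.mul_mem_left _ _ _ h
    | add y z hy hz => rw [map_add, map_add]; exact add_mem hy hz
    | tensor w a =>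
      rw [shZeroEquiv_shD_tensor]
      exact TwoSidedIdeal.mul_mem_right _ _ _ (TwoSidedIdeal.mul_mem_left _ _ _
        (TwoSidedIdeal.subset_span ⟨w 0, rfl⟩))

variable (𝒜 : ℕ → Submodule K R) (e : J → ℕ)

theorem mem_shFil_zero_iff {p : ℕ} {z : Sh K R J 0} :
    z ∈ shFil 𝒜 e 0 p ↔ shZeroEquiv K R J z ∈ gradingFil 𝒜 p := by
  constructor
  · intro hz
    refine (Submodule.span_le (p := (gradingFil 𝒜 p).comap (shZeroEquiv K R J).toLinearMap)).2 ?_ hz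
    rintro _ ⟨w, a, d, ha, hd, rfl⟩
    exact mem_gradingFil 𝒜 (by simpa using hd) (by simpa using ha 0)
  · intro hz
    have h : gradingFil 𝒜 p ≤ (shFil 𝒜 e 0 p).comap (shZeroEquiv K R J).symm.toLinearMap := by
      refine iSup₂_le fun i hi x hx => Submodule.subset_span
        ⟨default, fun _ => x, fun _ => i, fun _ => hx, by simpa using hi, ?_⟩
      exact (LinearEquiv.symm_apply_eq _).2 (by simp)
    simpa using h hz

variable [GradedAlgebra 𝒜]

theorem shZeroEquiv_shProj (p : ℕ) (z : Sh K R J 0) :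
    shZeroEquiv K R J (shProj 𝒜 e 0 p z) = component 𝒜 p (shZeroEquiv K R J z) := by
  have hz : z ∈ ⨆ p, shDeg 𝒜 e 0 p := iSup_shDeg (K := K) 𝒜 e 0 ▸ Submodule.mem_top
  have hmem : ∀ q, ∀ x ∈ shDeg 𝒜 e 0 q, shZeroEquiv K R J x ∈ 𝒜 q := by
    intro q x hx
    refine (Submodule.span_le (p := (𝒜 q).comap (shZeroEquiv K R J).toLinearMap)).2 ?_ hx
    rintro _ ⟨w, a, d, ha, rfl, rfl⟩
    simpa using ha 0
  induction hz using Submodule.iSup_induction' with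
  | zero => simp
  | add x y _ _ hx hy => simp only [map_add, hx, hy]
  | mem q x hx =>
    rw [shProj_of_mem 𝒜 e hx, component_of_mem 𝒜 (hmem q x hx)]
    split_ifs <;> simp

end DegreeZero

/-! ### Strictness of `d_1` and the equality `⟨LH(F)⟩ = ⟨LH(I)⟩`. -/

section Strict

variable {K R J : Type*} [Field K] [Ring R] [Algebra K R]
variable (𝒜 : ℕ → Submodule K R) [GradedAlgebra 𝒜] (f : J → R)

theorem span_LHs_le {I : TwoSidedIdeal R} (hf : TwoSidedIdeal.span (Set.range f) = I) :
    TwoSidedIdeal.span (Set.range (LHs 𝒜 f)) ≤ TwoSidedIdeal.span (LH 𝒜 '' (I : Set R)) := by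
  rw [TwoSidedIdeal.span_le]
  rintro _ ⟨j, rfl⟩
  exact TwoSidedIdeal.subset_span ⟨f j, hf ▸ TwoSidedIdeal.subset_span ⟨j, rfl⟩, rfl⟩

/-- `⟨LH(F)⟩ = ⟨LH(I)⟩` exactly when `d_1` of `Sh(X | F, R)` is strict. -/
theorem span_LHs_eq_iff_strict {I : TwoSidedIdeal R} (hf : TwoSidedIdeal.span (Set.range f) = I) :
    TwoSidedIdeal.span (Set.range (LHs 𝒜 f)) = TwoSidedIdeal.span (LH 𝒜 '' (I : Set R)) ↔
      StrictDifferential 𝒜 f 0 := by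
  constructor
  · intro h q y hy
    induction q using Nat.strong_induction_on generalizing y with | _ q ih
    have hr := (mem_shFil_zero_iff 𝒜 _).1 hy
    have hI : shZeroEquiv K R J (shD K f 0 y) ∈ I := hf ▸ (mem_span_range_iff f _).2 ⟨y, rfl⟩
    have hc : component 𝒜 q (shZeroEquiv K R J (shD K f 0 y)) ∈
        TwoSidedIdeal.span (Set.range (LHs 𝒜 f)) := by
      rcases component_eq_LH_or_eq_zero 𝒜 hr with h' | h' <;> rw [h']
      · rw [h]
        exact TwoSidedIdeal.subset_span ⟨_, hI, rfl⟩
      · exact zero_mem _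
    obtain ⟨x, hx⟩ := (mem_span_range_iff (K := K) _ _).1 hc
    have hxF := shDeg_le_shFil 𝒜 _ _ _ (shProj_mem 𝒜 (degs 𝒜 f) 1 q x)
    -- Only the degree-`q` part of `x` matters, since the element to be hit is homogeneous of degree
    -- `q`.
    have hx' : shD K (LHs 𝒜 f) 0 (shProj 𝒜 (degs 𝒜 f) 1 q x) =
        shProj 𝒜 (degs 𝒜 f) 0 q (shD K f 0 y) := by
      apply (shZeroEquiv K R J).injective
      rw [← shProj_shD_LHs, shZeroEquiv_shProj, hx, shZeroEquiv_shProj,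
        component_of_mem 𝒜 (component_mem 𝒜 q _), if_pos rfl]
    -- The top part of `d_F y` is cancelled by that of `d_F` of the homogeneous correction; both
    -- remainders lie in `F_{q-1}`.
    have hd : shD K f 0 (y - shProj 𝒜 (degs 𝒜 f) 1 q x) ∈ prev (shFil 𝒜 (degs 𝒜 f) 0) q := by
      have := sub_mem (sub_shProj_mem_prev 𝒜 _ hy) (shD_sub_shD_LHs_mem 𝒜 f hxF)
      rwa [← hx', sub_sub_sub_cancel_right, ← map_sub] at this
    cases q with
    | zero => exact ⟨_, hxF, (sub_eq_zero.1 ((map_sub _ _ _).symm.trans hd)).symm⟩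
    | succ q =>
      obtain ⟨y', hy', hyy⟩ := ih q q.lt_succ_self _ hd
      refine ⟨y' + shProj 𝒜 (degs 𝒜 f) 1 (q + 1) x,
        add_mem (shFil_mono 𝒜 _ _ q.le_succ hy') hxF, ?_⟩
      rw [map_add, hyy, ← map_add, sub_add_cancel]
  · refine fun h => le_antisymm (span_LHs_le 𝒜 f hf) ?_
    rw [TwoSidedIdeal.span_le]
    rintro _ ⟨r, hr, rfl⟩
    obtain ⟨y, rfl⟩ := (mem_span_range_iff (K := K) f r).1 (hf ▸ hr)
    -- Strictness is applied with `q = deg r`, so that the degree-`q` part of `y'` has `LH(r)` as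
    -- its `LH(F)`-boundary.
    obtain ⟨y', hy', hyy⟩ := h _ y ((mem_shFil_zero_iff 𝒜 _).2 (mem_gradingFil_deg 𝒜 _))
    refine (mem_span_range_iff (K := K) _ _).2 ⟨shProj 𝒜 (degs 𝒜 f) 1
      (deg 𝒜 (shZeroEquiv K R J (shD K f 0 y))) y', ?_⟩
    rw [shD_LHs_shProj 𝒜 f hy', hyy, shZeroEquiv_shProj, component_deg]

end Strict

/-! ### The natural map `R → G(R / I)` and its kernel. -/

section AssociatedGraded

theorem Gr.mk_eq_zero_iff {K A : Type*} [Field K] [Ring A] [Algebra K A] {F : ℕ → Submodule K A}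
    {p : ℕ} {a : A} (ha : a ∈ F p) : Gr.mk F p a ha = 0 ↔ a ∈ prev F p :=
  Submodule.Quotient.mk_eq_zero _

variable {K R J : Type*} [Field K] [Ring R] [Algebra K R]
variable (𝒜 : ℕ → Submodule K R) (I : TwoSidedIdeal R)

theorem mk_mem_quotFil {p : ℕ} {r : R} (hr : r ∈ gradingFil 𝒜 p) :
    Ideal.Quotient.mk I.asIdeal r ∈ quotFil 𝒜 I p := ⟨r, hr, rfl⟩

/-- For `p + 1` this unfolds the image filtration; for `p = 0` both sides say `r ∈ I`, since `F_{-1}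
= 0`. -/
theorem mk_mem_prev_quotFil_iff {p : ℕ} {r : R} :
    Ideal.Quotient.mk I.asIdeal r ∈ prev (quotFil 𝒜 I) p ↔
      ∃ s ∈ prev (gradingFil 𝒜) p, r - s ∈ I := by
  have hmk : ∀ s, r - s ∈ I ↔ Ideal.Quotient.mk I.asIdeal s = Ideal.Quotient.mk I.asIdeal r :=
    fun s => by rw [eq_comm, Ideal.Quotient.eq, TwoSidedIdeal.mem_asIdeal]
  simp only [hmk]
  cases p with
  | zero =>
    constructor
    · intro h
      have h0 : Ideal.Quotient.mk I.asIdeal r = 0 := h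
      exact ⟨0, zero_mem _, by rw [h0, map_zero]⟩
    · rintro ⟨s, hs, hsr⟩
      have h0 : s = 0 := hs
      rw [← hsr, h0, map_zero]
      exact zero_mem _
  | succ p => exact Iff.rfl

variable [GradedAlgebra 𝒜]

theorem natGr_of_mem {p : ℕ} {r : R} (hr : r ∈ 𝒜 p) :
    natGr 𝒜 I r = DirectSum.of (Gr (quotFil 𝒜 I)) p
      (Gr.mk (quotFil 𝒜 I) p (Ideal.Quotient.mk I.asIdeal r)
        (mk_mem_quotFil 𝒜 I (mem_gradingFil 𝒜 le_rfl hr))) := by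
  rw [natGr, LinearMap.comp_apply, LinearEquiv.coe_coe, DirectSum.decomposeLinearEquiv_apply,
    DirectSum.decompose_of_mem 𝒜 hr, ← DirectSum.lof_eq_of K, DirectSum.toModule_lof]
  rfl

theorem natGr_one : natGr 𝒜 I 1 = 1 :=
  natGr_of_mem 𝒜 I SetLike.GradedOne.one_mem

theorem natGr_mul (a b : R) : natGr 𝒜 I (a * b) = natGr 𝒜 I a * natGr 𝒜 I b := by
  induction a using DirectSum.Decomposition.inductionOn 𝒜 with
  | zero => simp
  | add a a' h h' => rw [add_mul, map_add, map_add, add_mul, h, h']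
  | @homogeneous p a =>
    induction b using DirectSum.Decomposition.inductionOn 𝒜 with
    | zero => simp
    | add b b' h h' => rw [mul_add, map_add, map_add, mul_add, h, h']
    | @homogeneous q b =>
      rw [natGr_of_mem 𝒜 I a.2, natGr_of_mem 𝒜 I b.2,
        natGr_of_mem 𝒜 I (SetLike.mul_mem_graded a.2 b.2), DirectSum.of_mul_of]
      rfl

/-- The natural graded map `φ : R → G(R / I)` as a homomorphism of algebras. -/
def natGrHom : R →ₐ[K] GrQuot 𝒜 I :=
  AlgHom.ofLinearMap (natGr 𝒜 I) (natGr_one 𝒜 I) (natGr_mul 𝒜 I)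

theorem natGrHom_apply (r : R) : natGrHom 𝒜 I r = natGr 𝒜 I r := rfl

/-- A class in `F_p A / F_{p-1} A` with representative `r ∈ F_p R` is also represented by the
degree-`p` component of `r`. -/
theorem natGr_surjective : Function.Surjective (natGr 𝒜 I) := by
  intro x
  induction x using DirectSum.induction_on with
  | zero => exact ⟨0, map_zero _⟩
  | add x y hx hy =>
    obtain ⟨a, rfl⟩ := hx
    obtain ⟨b, rfl⟩ := hy
    exact ⟨a + b, map_add _ _ _⟩
  | of p x =>
    induction x using Gr.ind with | _ a ha
    obtain ⟨r, hr, rfl⟩ := ha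
    refine ⟨component 𝒜 p r, ?_⟩
    rw [natGr_of_mem 𝒜 I (component_mem 𝒜 p r)]
    refine congrArg _ (((Gr.proj_eq_iff (F := quotFil 𝒜 I) ⟨_, _⟩ ⟨_, _⟩).2 ?_).symm)
    exact (map_sub (Ideal.Quotient.mk I.asIdeal) _ _).symm ▸ (mk_mem_prev_quotFil_iff 𝒜 I).2
      ⟨_, sub_component_mem_prev 𝒜 hr, by rw [sub_self]; exact zero_mem I⟩

theorem natGr_apply (r : R) (p : ℕ) : natGr 𝒜 I r p =
    Gr.mk (quotFil 𝒜 I) p (Ideal.Quotient.mk I.asIdeal (component 𝒜 p r))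
      (mk_mem_quotFil 𝒜 I (mem_gradingFil 𝒜 le_rfl (component_mem 𝒜 p r))) := by
  induction r using DirectSum.Decomposition.inductionOn 𝒜 with
  | zero =>
    rw [map_zero]
    exact ((Gr.mk_eq_zero_iff _).2 (by simp)).symm
  | add r s hr hs =>
    rw [map_add, DirectSum.add_apply, hr, hs]
    exact Gr.mk_eq (ha := add_mem (mk_mem_quotFil 𝒜 I (mem_gradingFil 𝒜 le_rfl (component_mem 𝒜 p r)))
      (mk_mem_quotFil 𝒜 I (mem_gradingFil 𝒜 le_rfl (component_mem 𝒜 p s)))) (by simp)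
  | @homogeneous q r =>
    rw [natGr_of_mem 𝒜 I r.2]
    by_cases h : q = p
    · subst h
      rw [DirectSum.of_eq_same]
      exact Gr.mk_eq (by rw [component_of_mem 𝒜 r.2, if_pos rfl])
    · rw [DirectSum.of_eq_of_ne _ _ _ (Ne.symm h)]
      refine ((Gr.mk_eq_zero_iff _).2 ?_).symm
      simp [component_of_mem 𝒜 r.2, h]

/-- The kernel of the natural map `R → G(R / I)` is `⟨LH(I)⟩`. -/
theorem natGr_eq_zero_iff (r : R) :
    natGr 𝒜 I r = 0 ↔ r ∈ TwoSidedIdeal.span (LH 𝒜 '' (I : Set R)) := by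
  classical
  constructor
  · intro h
    rw [← DirectSum.sum_support_decompose 𝒜 r]
    refine sum_mem fun p _ => ?_
    change component 𝒜 p r ∈ _
    have hp : Gr.mk (quotFil 𝒜 I) p _ _ = 0 :=
      (natGr_apply 𝒜 I r p).symm.trans (congrArg (fun x : GrQuot 𝒜 I => x p) h)
    obtain ⟨s, hs, hsr⟩ := (mk_mem_prev_quotFil_iff 𝒜 I).1 ((Gr.mk_eq_zero_iff _).1 hp)
    -- The degree-`p` component of `r` reappears as that of `component 𝒜 p r - s`, which lies in
    -- `I`, because `s` has filtration below `p`.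
    have hc : component 𝒜 p (component 𝒜 p r - s) = component 𝒜 p r := by
      rw [map_sub, component_of_mem 𝒜 (component_mem 𝒜 p r), if_pos rfl,
        component_eq_zero_of_mem_prev 𝒜 hs, sub_zero]
    rcases component_eq_LH_or_eq_zero 𝒜 (p := p) (r := component 𝒜 p r - s)
      (sub_mem (mem_gradingFil 𝒜 le_rfl (component_mem 𝒜 p r))
        (prev_le (gradingFil_mono 𝒜) p hs)) with h' | h'
    · rw [← hc, h']
      exact TwoSidedIdeal.subset_span ⟨_, hsr, rfl⟩
    · rw [← hc, h']
      exact zero_mem _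
  · intro hr
    have hle : TwoSidedIdeal.span (LH 𝒜 '' (I : Set R)) ≤ TwoSidedIdeal.ker (natGrHom 𝒜 I) := by
      rw [TwoSidedIdeal.span_le]
      rintro _ ⟨s, hs, rfl⟩
      refine (TwoSidedIdeal.mem_ker _).2 ?_
      rw [natGrHom_apply, natGr_of_mem 𝒜 I (LH_mem 𝒜 s)]
      refine (congrArg _ ((Gr.mk_eq_zero_iff _).2 ?_)).trans (map_zero _)
      -- Modulo `I`, the leading part of `s ∈ I` equals minus the rest of `s`, which has lower
      -- filtration.
      refine (mk_mem_prev_quotFil_iff 𝒜 I).2 ⟨-(s - LH 𝒜 s), neg_mem (sub_LH_mem 𝒜 s), ?_⟩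
      rw [sub_neg_eq_add, add_sub_cancel]
      exact hs
    exact (TwoSidedIdeal.mem_ker (natGrHom 𝒜 I)).1 (hle hr)

/-- The natural map induces an isomorphism `R / L ≃ G(R / I)` exactly when `L = ⟨LH(I)⟩`. -/
theorem exists_algEquiv_grQuot_iff (L : TwoSidedIdeal R) :
    (∃ ρ : (R ⧸ L.asIdeal) ≃ₐ[K] GrQuot 𝒜 I,
      ∀ r : R, ρ (Ideal.Quotient.mk _ r) = natGr 𝒜 I r) ↔
        L = TwoSidedIdeal.span (LH 𝒜 '' (I : Set R)) := by
  constructor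
  · rintro ⟨ρ, hρ⟩
    ext r
    rw [← natGr_eq_zero_iff, ← hρ, map_eq_zero_iff ρ ρ.injective, Ideal.Quotient.eq_zero_iff_mem,
      TwoSidedIdeal.mem_asIdeal]
  · rintro rfl
    refine ⟨AlgEquiv.ofBijective (Ideal.Quotient.liftₐ _ (natGrHom 𝒜 I) fun r hr =>
      (natGr_eq_zero_iff 𝒜 I r).2 (TwoSidedIdeal.mem_asIdeal.1 hr)) ⟨?_, ?_⟩, fun r => rfl⟩
    · rw [injective_iff_map_eq_zero]
      intro x hx
      obtain ⟨r, rfl⟩ := Ideal.Quotient.mk_surjective x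
      exact Ideal.Quotient.eq_zero_iff_mem.2
        (TwoSidedIdeal.mem_asIdeal.2 ((natGr_eq_zero_iff 𝒜 I r).1 hx))
    · intro x
      obtain ⟨r, rfl⟩ := natGr_surjective 𝒜 I x
      exact ⟨Ideal.Quotient.mk _ r, rfl⟩

end AssociatedGraded

end PBW

theorem theorem3p1 {K R J : Type*} [Field K] [Ring R] [Algebra K R]
    (𝒜 : ℕ → Submodule K R) [GradedAlgebra 𝒜]
    (I : TwoSidedIdeal R) (f : J → R) (hf : TwoSidedIdeal.span (Set.range f) = I) :
    List.TFAE [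
      TwoSidedIdeal.span (Set.range fun j => PBW.LH 𝒜 (f j)) =
        TwoSidedIdeal.span (PBW.LH 𝒜 '' (I : Set R)),
      ∃ ρ : (R ⧸ (TwoSidedIdeal.span (Set.range fun j => PBW.LH 𝒜 (f j))).asIdeal) ≃ₐ[K]
          PBW.GrQuot 𝒜 I,
        ∀ r : R, ρ (Ideal.Quotient.mk _ r) = PBW.natGr 𝒜 I r,
      PBW.extendableHomology 𝒜 f 0 = ⊤,
      PBW.bimoduleSpan (PBW.LHs 𝒜 f) 0 {h | ∃ p, h ∈ PBW.extendable 𝒜 f 0 p} = ⊤] := by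
  tfae_have 2 ↔ 1 := PBW.exists_algEquiv_grQuot_iff 𝒜 I _
  tfae_have 1 ↔ 3 := (PBW.span_LHs_eq_iff_strict 𝒜 f hf).trans
    (PBW.extendableHomology_eq_top_iff_strict 𝒜 f 0).symm
  tfae_have 4 ↔ 3 := by rw [PBW.bimoduleSpan_extendable]
  tfae_finish
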